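/- Let $M$ be a closed smooth manifold and $N\subseteq M$ a closed (compact, without boundary) embedded smooth submanifold, and let $g$ be a Riemannian metric on $M$. Assume that the normal bundle $E=(TN)^{\perp_g}\to N$ of $N$ in $M$ has a continuous nowhere-vanishing section. Let $R$ be a commutative unital ring and take singular homology with coefficients in $R$. Let $\Lambda M$ be the free loop space of absolutely continuous loops $\gamma\colon[0,1]\to M$, $\gamma(0)=\gamma(1)$, with $\int_0^1|\dot\gamma(t)|^2\,dt<\infty$, equipped with the $H^1$-topology, and regard $M\subseteq\Lambda M$ as the subspace of trivial loops; similarly for $N\subseteq\Lambda N$. For $k\ge 0$ and a class $Y\in H_k(\Lambda M,M)$, the intersection multiplicity of $Y$ is $$\mathrm{int}_{\Lambda M}(Y)=\inf_{A}\Big(\sup\big\{\#\{t\in[0,1] : \gamma(t)=\gamma(0)\} \;:\; \gamma\in\mathrm{im}(A),\ \textstyle\int_0^1|\dot\gamma(t)|_g^2\,dt>0\big\}\Big)-1,$$ where $A$ runs over all singular cycles $A\in C_k(\Lambda M)$ representing $Y$, $\mathrm{im}(A)\subseteq \Lambda M$ is the union of the images of the singular simplices that occur in $A$ with nonzero coefficient,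 and $\sup\emptyset=0$. Let $i_*\colon H_k(\Lambda N,N)\to H_k(\Lambda M,M)$ be induced by the inclusion. Then for every $k\ge 0$ and every $X\in H_k(\Lambda N,N)$ one has $\mathrm{int}_{\Lambda M}(i_*X)\le 1$, and if $i_*X\neq 0$, then $$\mathrm{int}_{\Lambda M}(i_*X)=1.$$ -/

import Mathlib

open CategoryTheory CategoryTheory.Limits MeasureTheory
open scoped Manifold ContDiff Topology unitInterval

universe u

namespace LoopHomology

noncomputable section

section RelativeHomology

open scoped Simplicial

variable (R : Type u) [CommRing R]

/-- The singular chain complex `C_•(X)` with coefficients in the commutative ring `R`. -/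
abbrev singularChains (X : TopCat.{u}) : ChainComplex (ModuleCat.{u} R) ℕ :=
  ((AlgebraicTopology.singularChainComplexFunctor (ModuleCat.{u} R)).obj (ModuleCat.of R R)).obj X

/-- The chain map `C_•(X) ⟶ C_•(Y)` induced by a continuous map. -/
abbrev singularChainsMap {X Y : TopCat.{u}} (f : X ⟶ Y) :
    singularChains R X ⟶ singularChains R Y :=
  ((AlgebraicTopology.singularChainComplexFunctor (ModuleCat.{u} R)).obj (ModuleCat.of R R)).map f

/-- The coefficient of a singular `k`-chain (an element of a direct sum of copies of `R` indexed by
the singular `k`-simplices) at the singular simplex `s`. -/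
def chainCoeff (X : TopCat.{u}) (k : ℕ) (s : (TopCat.toSSet.obj X) _⦋k⦌) :
    (singularChains R X).X k ⟶ ModuleCat.of R R :=
  open scoped Classical in
  Sigma.desc (f := fun _ : (TopCat.toSSet.obj X) _⦋k⦌ => ModuleCat.of R R)
    (fun t => if t = s then 𝟙 (ModuleCat.of R R) else 0)

/-- The image `im(c) ⊆ X` of a singular `k`-chain `c`: the union of the images of the singular
simplices which occur in `c` with nonzero coefficient. -/
def chainImage (X : TopCat.{u}) (k : ℕ) (c : (singularChains R X).X k) : Set X :=
  {x | ∃ s : (TopCat.toSSet.obj X) _⦋k⦌, chainCoeff R X k s c ≠ 0 ∧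
    x ∈ Set.range (TopCat.toSSetObjEquiv X _ s)}

/-- The relative singular chain complex `C_•(X, A) = C_•(X) / C_•(A)` of a topological pair. -/
def relativeChains (P : TopPair.{u}) : ChainComplex (ModuleCat.{u} R) ℕ :=
  cokernel (singularChainsMap R P.map)

/-- The projection `C_•(X) ⟶ C_•(X, A)`. -/
def relativeChainsProj (P : TopPair.{u}) : singularChains R P.fst ⟶ relativeChains R P :=
  cokernel.π (singularChainsMap R P.map)

/-- The chain map of relative chain complexes induced by a map of pairs. -/
def relativeChainsMap {P Q : TopPair.{u}} (f : P ⟶ Q) : relativeChains R P ⟶ relativeChains R Q :=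
  cokernel.map _ _ (singularChainsMap R (TopPair.Hom.snd f))
    (singularChainsMap R (TopPair.Hom.fst f))
    (by rw [← Functor.map_comp, ← Functor.map_comp, TopPair.Hom.w])

/-- Relative singular homology `H_k(X, A)` with coefficients in `R`. -/
abbrev relativeHomology (P : TopPair.{u}) (k : ℕ) : ModuleCat.{u} R :=
  (relativeChains R P).homology k

/-- The map in relative homology induced by a map of pairs. -/
def relativeHomologyMap {P Q : TopPair.{u}} (f : P ⟶ Q) (k : ℕ) :
    relativeHomology R P k ⟶ relativeHomology R Q k :=
  HomologicalComplex.homologyMap (relativeChainsMap R f) k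

/-- The relative homology class in `H_k(X, A)` of an absolute cycle `z ∈ Z_k(X)`. -/
def relativeClass (P : TopPair.{u}) (k : ℕ) (z : (singularChains R P.fst).cycles k) :
    relativeHomology R P k :=
  HomologicalComplex.homologyMap (relativeChainsProj R P) k
    ((singularChains R P.fst).homologyπ k z)

end RelativeHomology

section LoopSpace

variable {m n : ℕ}
  {M : Type u} [TopologicalSpace M] [ChartedSpace (EuclideanSpace ℝ (Fin m)) M]
  {N : Type u} [TopologicalSpace N] [ChartedSpace (EuclideanSpace ℝ (Fin n)) N]

/-- The function `f ∘ γ`, extended from `[0,1]` to `ℝ` by constants. -/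
def alongCurve (f : C^∞⟮𝓡 m, M; 𝓘(ℝ), ℝ⟯) (γ : C(I, M)) : ℝ → ℝ :=
  Set.IccExtend (zero_le_one' ℝ) (fun t => f (γ t))

/-- A continuous curve `γ : [0,1] → M` is of class `H¹` (absolutely continuous with square
integrable derivative) if for every smooth function `f : M → ℝ` the function `f ∘ γ` is absolutely
continuous with square integrable derivative. Taking for `f` the coordinates of a chart multiplied
by bump functions, one sees that on a closed manifold this is the same as absolute continuity of
`γ` in charts together with `∫ |γ'(t)|² dt < ∞` for one (hence every) Riemannian metric. -/
structure IsH1Curve (m : ℕ) {M : Type u} [TopologicalSpace M]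
    [ChartedSpace (EuclideanSpace ℝ (Fin m)) M] (γ : C(I, M)) : Prop where
  absolutelyContinuous (f : C^∞⟮𝓡 m, M; 𝓘(ℝ), ℝ⟯) :
    AbsolutelyContinuousOnInterval (alongCurve f γ) 0 1
  memLp_deriv (f : C^∞⟮𝓡 m, M; 𝓘(ℝ), ℝ⟯) :
    MemLp (deriv (alongCurve f γ)) 2 (volume.restrict (Set.Icc 0 1))

variable (m M) in
/-- The free loop space `ΛM` of loops `γ : [0,1] → M` of class `H¹`. -/
def FreeLoop : Type u := {γ : C(I, M) // γ 0 = γ 1 ∧ IsH1Curve m γ}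

namespace FreeLoop

/-- The underlying continuous curve. -/
def curve (γ : FreeLoop m M) : C(I, M) := γ.1

/-- The weak derivative of `f ∘ γ` as an element of `L²([0,1])`. -/
def derivAlong (f : C^∞⟮𝓡 m, M; 𝓘(ℝ), ℝ⟯) (γ : FreeLoop m M) :
    Lp ℝ 2 (volume.restrict (Set.Icc (0 : ℝ) 1)) :=
  (γ.2.2.memLp_deriv f).toLp _

/-- The `H¹`-topology on `ΛM`: the coarsest topology which is finer than the compact-open topology
and for which `γ ↦ (f ∘ γ)' ∈ L²([0,1])` is continuous for all smooth `f : M → ℝ`. For a closed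
manifold `M` this is the topology of the Hilbert manifold `ΛM`, i.e. the subspace
topology of `ΛM ⊆ H¹([0,1], ℝ^q)` for any smooth embedding `M ⊆ ℝ^q`, the `H¹`-norm on functions
on `[0,1]` being equivalent to the sum of the sup norm and the `L²`-norm of the derivative. -/
instance instTopologicalSpace : TopologicalSpace (FreeLoop m M) :=
  TopologicalSpace.induced curve inferInstance ⊓
    ⨅ f : C^∞⟮𝓡 m, M; 𝓘(ℝ), ℝ⟯, TopologicalSpace.induced (derivAlong f) inferInstance

lemma continuous_iff {X : Type*} [TopologicalSpace X] (F : X → FreeLoop m M) :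
    Continuous F ↔ Continuous (fun x => (F x).curve) ∧
      ∀ f : C^∞⟮𝓡 m, M; 𝓘(ℝ), ℝ⟯, Continuous (fun x => derivAlong f (F x)) := by
  refine Iff.trans (continuous_inf_rng
    (t₂ := TopologicalSpace.induced (curve : FreeLoop m M → C(I, M)) inferInstance)
    (t₃ := ⨅ f : C^∞⟮𝓡 m, M; 𝓘(ℝ), ℝ⟯,
      TopologicalSpace.induced (derivAlong f : FreeLoop m M → _) inferInstance)) ?_
  refine and_congr continuous_induced_rng (continuous_iInf_rng.trans ?_)
  exact forall_congr' fun f => continuous_induced_rng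

lemma continuous_curve : Continuous (curve : FreeLoop m M → C(I, M)) :=
  ((continuous_iff id).1 continuous_id).1

lemma continuous_derivAlong (f : C^∞⟮𝓡 m, M; 𝓘(ℝ), ℝ⟯) :
    Continuous (derivAlong f : FreeLoop m M → _) :=
  ((continuous_iff id).1 continuous_id).2 f

lemma alongCurve_const (f : C^∞⟮𝓡 m, M; 𝓘(ℝ), ℝ⟯) (p : M) :
    alongCurve f (ContinuousMap.const I p) = fun _ => f p := rfl

lemma isH1Curve_const (p : M) : IsH1Curve m (ContinuousMap.const I p) where
  absolutelyContinuous f := by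
    rw [alongCurve_const, absolutelyContinuousOnInterval_iff]
    intro ε hε
    exact ⟨1, one_pos, fun _ _ _ => by simpa using hε⟩
  memLp_deriv f := by
    rw [alongCurve_const]
    simp

variable (m) in
/-- The trivial loop at `p`. -/
def trivial (p : M) : FreeLoop m M := ⟨ContinuousMap.const I p, rfl, isH1Curve_const p⟩

lemma continuous_trivial : Continuous (trivial m : M → FreeLoop m M) := by
  rw [continuous_iff]
  refine ⟨ContinuousMap.const'.continuous, fun f => ?_⟩
  have h : ∀ p : M, derivAlong f (trivial m p) = 0 := fun p => by
    rw [Lp.eq_zero_iff_ae_eq_zero]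
    refine (MemLp.coeFn_toLp _).trans (Filter.Eventually.of_forall fun t => ?_)
    exact deriv_const t (f p)
  simp only [h]
  exact continuous_const

lemma isEmbedding_trivial : Topology.IsEmbedding (trivial m : M → FreeLoop m M) :=
  Topology.IsEmbedding.of_leftInverse (f := fun γ : FreeLoop m M => γ.curve 0)
    (fun _ => rfl) ((continuous_eval_const (0 : I)).comp continuous_curve)
    continuous_trivial

/-- The map of loop spaces `Λφ : ΛN → ΛM`, `γ ↦ φ ∘ γ`, induced by a smooth map `φ : N → M`. -/
def map (φ : C^∞⟮𝓡 n, N; 𝓡 m, M⟯) (γ : FreeLoop n N) : FreeLoop m M :=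
  ⟨(⟨φ, φ.contMDiff.continuous⟩ : C(N, M)).comp γ.curve, congrArg φ γ.2.1,
    fun f => γ.2.2.1 (f.comp φ), fun f => γ.2.2.2 (f.comp φ)⟩

lemma continuous_map (φ : C^∞⟮𝓡 n, N; 𝓡 m, M⟯) :
    Continuous (map φ : FreeLoop n N → FreeLoop m M) := by
  rw [continuous_iff]
  exact ⟨(ContinuousMap.continuous_postcomp _).comp continuous_curve,
    fun f => continuous_derivAlong (f.comp φ)⟩

end FreeLoop

variable (m M) in
/-- The topological pair `(ΛM, M)`, where `M` is embedded as the trivial loops. -/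
abbrev loopPair : TopPair.{u} :=
  TopPair.of (A := TopCat.of M) (X := TopCat.of (FreeLoop m M))
    (TopCat.ofHom ⟨FreeLoop.trivial m, FreeLoop.continuous_trivial⟩) FreeLoop.isEmbedding_trivial

/-- The map of pairs `(ΛN, N) → (ΛM, M)` induced by a smooth map `N → M`. -/
def loopPairMap (φ : C^∞⟮𝓡 n, N; 𝓡 m, M⟯) : loopPair n N ⟶ loopPair m M :=
  TopPair.ofHom (X := loopPair n N) (Y := loopPair m M)
    (TopCat.ofHom ⟨FreeLoop.map φ, FreeLoop.continuous_map φ⟩)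
    (TopCat.ofHom ⟨φ, φ.contMDiff.continuous⟩) rfl

end LoopSpace

section Multiplicity

variable {m n : ℕ}
  {M : Type u} [TopologicalSpace M] [ChartedSpace (EuclideanSpace ℝ (Fin m)) M]
  [IsManifold (𝓡 m) ∞ M]
  {N : Type u} [TopologicalSpace N] [ChartedSpace (EuclideanSpace ℝ (Fin n)) N]

variable (m M) in
/-- Smooth Riemannian metrics on `M`. -/
abbrev RiemannianMetric : Type u :=
  Bundle.ContMDiffRiemannianMetric (𝓡 m) ∞ (EuclideanSpace ℝ (Fin m))
    (fun p : M => TangentSpace (𝓡 m) p)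

/-- The curve extended from `[0,1]` to `ℝ` by constants. -/
def FreeLoop.extend (γ : FreeLoop m M) : ℝ → M := Set.IccExtend (zero_le_one' ℝ) γ.curve

/-- The velocity vector `γ'(t)`, which exists for almost every `t ∈ [0,1]`. -/
def FreeLoop.velocity (γ : FreeLoop m M) (t : ℝ) : TangentSpace (𝓡 m) (γ.extend t) :=
  mfderiv 𝓘(ℝ) (𝓡 m) γ.extend t (1 : ℝ)

/-- The energy `∫₀¹ |γ'(t)|² dt` of a loop with respect to the Riemannian metric `g`. -/
def energy (g : RiemannianMetric m M) (γ : FreeLoop m M) : ENNReal :=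
  ∫⁻ t in Set.Icc (0 : ℝ) 1,
    ENNReal.ofReal (g.inner (γ.extend t) (γ.velocity t) (γ.velocity t))

/-- The number of parameters `t ∈ [0,1]` with `γ(t) = γ(0)`; both endpoints are counted. -/
def basepointCount (γ : FreeLoop m M) : ℕ∞ :=
  {t : I | γ.curve t = γ.curve 0}.encard

/-- The intersection multiplicity
`int_Λ(Y) = inf_A sup {#γ⁻¹(γ(0)) | γ ∈ im(A), energy(γ) > 0} - 1`
of a class `Y ∈ H_k(ΛM, M)`, where `A` runs over the singular cycles of `ΛM` representing `Y`.
The supremum is taken in `ℕ ∪ {∞}`, so that it is `0` for the empty set; the difference is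
taken in the extended reals, so that it is not truncated. Two absolute cycles
representing `Y` differ up to homology by a cycle of trivial loops, which does not affect the
supremum; so `A` may be restricted to the homology class of any one of them. -/
def intersectionMultiplicity (R : Type u) [CommRing R] (g : RiemannianMetric m M) (k : ℕ)
    (Y : relativeHomology R (loopPair m M) k) : EReal :=
  (((⨅ (A : (singularChains R (TopCat.of (FreeLoop m M))).cycles k)
      (_ : relativeClass R (loopPair m M) k A = Y),
      ⨆ (γ : FreeLoop m M)
        (_ : γ ∈ chainImage R (TopCat.of (FreeLoop m M)) k
          ((singularChains R (TopCat.of (FreeLoop m M))).iCycles k A))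
        (_ : 0 < energy g γ),
        basepointCount γ : ℕ∞) : ENNReal) : EReal) - 1

/-- The fibre at `p ∈ N` of the normal bundle of an immersion `φ : N → M`: the orthogonal complement
of `dφ(T_p N)` in `T_{φ(p)} M` with respect to the Riemannian metric `g` on `M`. -/
def normalSpace (g : RiemannianMetric m M) (φ : N → M) (p : N) :
    Submodule ℝ (TangentSpace (𝓡 m) (φ p)) where
  carrier := {w | ∀ v : TangentSpace (𝓡 n) p, g.inner (φ p) (mfderiv (𝓡 n) (𝓡 m) φ p v) w = 0}
  add_mem' ha hb v := by rw [map_add, ha v, hb v, add_zero]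
  zero_mem' v := map_zero _
  smul_mem' c _ ha v := by rw [map_smul, ha v, smul_zero]

/-- The normal bundle of `φ : N → M` has a continuous nowhere vanishing section. The normal
bundle is topologized as a subbundle of the pullback `φ^* TM`. -/
def HasNowhereVanishingNormalSection (g : RiemannianMetric m M) (φ : N → M) : Prop :=
  ∃ s : ∀ p : N, normalSpace (n := n) g φ p,
    Continuous (fun p : N =>
      (⟨φ p, (s p : TangentSpace (𝓡 m) (φ p))⟩ : TangentBundle (𝓡 m) M)) ∧
    ∀ p : N, s p ≠ 0

end Multiplicity

end

end LoopHomology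

/-! Upper bound. A nowhere vanishing normal section `s` lets the loops be pushed off `N` everywhere
except at the base point. Suppose `F τ` is a smooth family of self-maps of `M` with `F 0 = id` whose
initial velocity along `N` has positive scalar product with `s`. That velocity is nowhere tangent to
`N`, so by compactness `F τ` moves `N` off itself for `0 < τ < δ` (`exists_forall_notMem_range`).
Replace `γ(t)` by `F (δ t (1 - t)) (γ(t))`: the base point stays in `N`, and every point with `0 < t
< 1` leaves `N`. The new loop therefore meets its base point only at `t = 0, 1`, and scaling the
time by `s ∈ [0,1]` gives a homotopy from the inclusion `ΛN → ΛM`. Pushing a cycle forward along the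
end map represents `i_* X` with at most two base point parameters per loop
(`exists_homotopy_basepointCount_le_two`).

Lower bound. Every loop has at least the two parameters `0` and `1`. If the supremum for a
representing cycle is below `2`, no loop in its image has positive energy; loops of zero energy are
constant (`eq_trivial_of_energy_eq_zero`), so the cycle lies in `M` and its relative class vanishes.

The `H¹` topology is handled by testing against smooth functions. No flow is integrated: `F` is a
finite composition of chart translations with cutoffs, each of which turns a smooth `f` into a
smooth function of `τ` and finitely many smooth functions on `M` (`IsSmoothFamily`). Continuity of
the homotopy is then a statement about composing `H¹` functions with a `C¹` function
(`IsH1Family.comp_contDiff`). -/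

namespace LoopHomology

noncomputable section

/-! ### Singular chains as finite sums of simplices; images of chains -/

section Chains

open scoped Simplicial

variable (R : Type u) [CommRing R]

/-- The inclusion of the summand of `C_k(X)` indexed by the singular simplex `s`. -/
abbrev simplexChain (X : TopCat.{u}) (k : ℕ) (s : (TopCat.toSSet.obj X) _⦋k⦌) :
    ModuleCat.of R R ⟶ (singularChains R X).X k :=
  SSet.ιChainComplex _ s

lemma simplexChain_map {X Y : TopCat.{u}} (f : X ⟶ Y) (k : ℕ)
    (s : (TopCat.toSSet.obj X) _⦋k⦌) :
    simplexChain R X k s ≫ (singularChainsMap R f).f k =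
      simplexChain R Y k ((TopCat.toSSet.map f).app _ s) :=
  SSet.ι_chainComplexMap_f (f := TopCat.toSSet.map f) _ _ (ModuleCat.of R R) s

lemma simplexChain_chainCoeff (X : TopCat.{u}) (k : ℕ) (s t : (TopCat.toSSet.obj X) _⦋k⦌) :
    open scoped Classical in
    simplexChain R X k t ≫ chainCoeff R X k s = if t = s then 𝟙 (ModuleCat.of R R) else 0 :=
  Sigma.ι_desc _ _

variable {R} in
lemma singularChains_hom_ext {X : TopCat.{u}} {k : ℕ} {T : ModuleCat.{u} R}
    {f g : (singularChains R X).X k ⟶ T}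
    (h : ∀ s, simplexChain R X k s ≫ f = simplexChain R X k s ≫ g) : f = g :=
  SSet.chainComplex_hom_ext h

/-- The chain group is known only through its universal property, so generation is shown by noting
that the quotient by the span of the simplices kills every summand. -/
lemma exists_chain_eq_sum {X : TopCat.{u}} {k : ℕ} (c : (singularChains R X).X k) :
    ∃ a : (TopCat.toSSet.obj X) _⦋k⦌ →₀ R,
      (a.sum fun s r => r • simplexChain R X k s (1 : R)) = c := by
  let p : Submodule R ((singularChains R X).X k) :=
    Submodule.span R (Set.range fun s => simplexChain R X k s (1 : R))
  have h : (ModuleCat.ofHom p.mkQ : (singularChains R X).X k ⟶ _) = 0 := by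
    refine singularChains_hom_ext (fun s => Eq.trans ?_ comp_zero.symm)
    ext
    exact (Submodule.Quotient.mk_eq_zero p).2 (Submodule.subset_span ⟨s, rfl⟩)
  have hc : p.mkQ c = 0 := congr($h c)
  exact Finsupp.mem_span_range_iff_exists_finsupp.1 ((Submodule.Quotient.mk_eq_zero p).1 hc)

lemma chainCoeff_sum {X : TopCat.{u}} {k : ℕ} (a : (TopCat.toSSet.obj X) _⦋k⦌ →₀ R)
    (s : (TopCat.toSSet.obj X) _⦋k⦌) :
    chainCoeff R X k s (a.sum fun s r => r • simplexChain R X k s (1 : R)) = a s := by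
  classical
  have h (t) : chainCoeff R X k s (simplexChain R X k t (1 : R)) = if t = s then (1 : R) else 0 := by
    have := congr($(simplexChain_chainCoeff R X k s t) (1 : R))
    split_ifs at this ⊢ <;> exact this
  rw [Finsupp.sum, map_sum]
  simp only [map_smul, h]
  rw [Finset.sum_eq_single s]
  · simp
  · intro t _ hts
    simp [hts]
  · intro hs
    simp [Finsupp.notMem_support_iff.1 hs]

/-- A simplex with a point outside the range of `f` is not of the form `f ∘ t`, so its coefficient
functional kills the whole pushforward. -/
lemma chainImage_map_subset {X Y : TopCat.{u}} (f : X ⟶ Y) (k : ℕ) (c : (singularChains R X).X k) :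
    chainImage R Y k ((singularChainsMap R f).f k c) ⊆ Set.range f := by
  rintro _ ⟨s, hs, z, rfl⟩
  by_contra! hz
  refine hs ?_
  have h : (singularChainsMap R f).f k ≫ chainCoeff R Y k s = 0 := by
    refine singularChains_hom_ext (fun t => Eq.trans ?_ comp_zero.symm)
    refine ((Category.assoc _ _ _).symm.trans (eq_whisker (simplexChain_map R f k t) _)).trans
      ((simplexChain_chainCoeff R Y k s _).trans (if_neg fun hts => hz ?_))
    subst hts
    exact ⟨_, rfl⟩
  exact congr($h c)

/-- Along an embedding, each simplex that occurs lifts continuously; the others have coefficient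
zero and need no lift. -/
lemma exists_map_eq_of_chainImage_subset {A X : TopCat.{u}} (i : A ⟶ X)
    (hi : Topology.IsEmbedding i) (k : ℕ) (c : (singularChains R X).X k)
    (hc : chainImage R X k c ⊆ Set.range i) :
    ∃ d, (singularChainsMap R i).f k d = c := by
  obtain ⟨a, rfl⟩ := exists_chain_eq_sum R c
  have key (s) (hs : a s ≠ 0) : ∃ t, (TopCat.toSSet.map i).app _ t = s := by
    have hrange (z) : TopCat.toSSetObjEquiv X _ s z ∈ Set.range i :=
      hc ⟨s, by rwa [chainCoeff_sum], z, rfl⟩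
    choose g hg using hrange
    have hgc : Continuous g := by
      rw [hi.continuous_iff]
      exact (TopCat.toSSetObjEquiv X _ s).continuous.congr fun z => (hg z).symm
    refine ⟨(TopCat.toSSetObjEquiv A _).symm ⟨g, hgc⟩, (TopCat.toSSetObjEquiv X _).injective ?_⟩
    ext z
    exact hg z
  change _ ∈ LinearMap.range ((singularChainsMap R i).f k).hom
  refine Submodule.sum_mem _ fun s hs => Submodule.smul_mem _ _ ?_
  obtain ⟨t, rfl⟩ := key s (Finsupp.mem_support_iff.1 hs)
  exact ⟨simplexChain R A k t (1 : R), congr($(simplexChain_map R i k t) (1 : R))⟩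

end Chains

/-! ### Relative classes of absolute cycles -/

section RelativeClass

variable (R : Type u) [CommRing R]

lemma singularChainsMap_comp_relativeChainsProj (P : TopPair.{u}) :
    singularChainsMap R P.map ≫ relativeChainsProj R P = 0 :=
  cokernel.condition _

lemma relativeClass_eq (P : TopPair.{u}) (k : ℕ) (z : (singularChains R P.fst).cycles k) :
    relativeClass R P k z = (relativeChains R P).homologyπ k
      (HomologicalComplex.cyclesMap (relativeChainsProj R P) k z) :=
  congr($(HomologicalComplex.homologyπ_naturality (relativeChainsProj R P) k) z)

lemma relativeClass_eq_zero_of_chainImage_subset (P : TopPair.{u}) (k : ℕ)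
    (z : (singularChains R P.fst).cycles k)
    (hz : chainImage R P.fst k ((singularChains R P.fst).iCycles k z) ⊆ Set.range P.map) :
    relativeClass R P k z = 0 := by
  obtain ⟨d, hd⟩ := exists_map_eq_of_chainImage_subset R P.map P.isEmbedding_map k _ hz
  have h0 : HomologicalComplex.cyclesMap (relativeChainsProj R P) k z = 0 := by
    refine (ModuleCat.mono_iff_injective ((relativeChains R P).iCycles k)).1 inferInstance ?_
    rw [map_zero]
    have h1 : (relativeChains R P).iCycles k (HomologicalComplex.cyclesMap (relativeChainsProj R P) k z)
        = (relativeChainsProj R P).f k ((singularChains R P.fst).iCycles k z) :=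
      congr($(HomologicalComplex.cyclesMap_i (relativeChainsProj R P) k) z)
    rw [h1, ← hd]
    exact congr(($(singularChainsMap_comp_relativeChainsProj R P)).f k d)
  rw [relativeClass_eq, h0, map_zero]

/-- A retraction splits the pair: `1 - i ∘ r` on chains kills the subspace, hence descends to a
section of the projection to relative chains. This supplies absolute cycles, over which the
multiplicity is defined. -/
lemma relativeClass_surjective (P : TopPair.{u}) (r : P.fst ⟶ P.snd) (hr : P.map ≫ r = 𝟙 _)
    (k : ℕ) : Function.Surjective (relativeClass R P k) := by
  let i := singularChainsMap R P.map
  let p := singularChainsMap R r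
  have hip : i ≫ p = 𝟙 _ := by
    simp only [i, p, singularChainsMap, ← Functor.map_comp, hr]
    exact CategoryTheory.Functor.map_id _ _
  let q : relativeChains R P ⟶ singularChains R P.fst :=
    cokernel.desc i (𝟙 _ - p ≫ i) (by simp [reassoc_of% hip])
  have hq : q ≫ relativeChainsProj R P = 𝟙 _ := by
    have : Epi (relativeChainsProj R P) := inferInstanceAs (Epi (cokernel.π _))
    rw [← cancel_epi (relativeChainsProj R P)]
    have h1 : relativeChainsProj R P ≫ q = 𝟙 _ - p ≫ i := cokernel.π_desc _ _ _
    rw [reassoc_of% h1, Preadditive.sub_comp, Category.assoc,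
      singularChainsMap_comp_relativeChainsProj]
    simp
  intro X
  obtain ⟨z, hz⟩ := (ModuleCat.epi_iff_surjective ((singularChains R P.fst).homologyπ k)).1
    inferInstance (HomologicalComplex.homologyMap q k X)
  refine ⟨z, ?_⟩
  rw [relativeClass, hz]
  have := (HomologicalComplex.homologyMap_comp q (relativeChainsProj R P) k).symm
  rw [hq, HomologicalComplex.homologyMap_id] at this
  exact congr($this X)

lemma relativeHomologyMap_relativeClass {P Q : TopPair.{u}} (f : P ⟶ Q) (k : ℕ)
    (z : (singularChains R P.fst).cycles k) :
    relativeHomologyMap R f k (relativeClass R P k z) =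
      relativeClass R Q k
        (HomologicalComplex.cyclesMap (singularChainsMap R (TopPair.Hom.fst f)) k z) := by
  have h : relativeChainsProj R P ≫ relativeChainsMap R f =
      singularChainsMap R (TopPair.Hom.fst f) ≫ relativeChainsProj R Q :=
    cokernel.π_desc _ _ _
  have h1 : (singularChains R P.fst).homologyπ k ≫
      HomologicalComplex.homologyMap (relativeChainsProj R P) k ≫
        HomologicalComplex.homologyMap (relativeChainsMap R f) k =
      HomologicalComplex.cyclesMap (singularChainsMap R (TopPair.Hom.fst f)) k ≫
        (singularChains R Q.fst).homologyπ k ≫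
          HomologicalComplex.homologyMap (relativeChainsProj R Q) k := by
    rw [← HomologicalComplex.homologyMap_comp, h, HomologicalComplex.homologyMap_comp,
      HomologicalComplex.homologyπ_naturality_assoc]
  exact congr($h1 z)

lemma relativeClass_cyclesMap_eq_of_homotopy {X : TopCat.{u}} {P : TopPair.{u}} {f g : X ⟶ P.fst}
    (H : TopCat.Homotopy f g) (k : ℕ) (z : (singularChains R X).cycles k) :
    relativeClass R P k (HomologicalComplex.cyclesMap (singularChainsMap R f) k z) =
      relativeClass R P k (HomologicalComplex.cyclesMap (singularChainsMap R g) k z) := by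
  have h := H.congr_homologyMap_singularChainComplexFunctor (ModuleCat.of R R) k
  have h1 : HomologicalComplex.cyclesMap (singularChainsMap R f) k ≫
        (singularChains R P.fst).homologyπ k =
      HomologicalComplex.cyclesMap (singularChainsMap R g) k ≫
        (singularChains R P.fst).homologyπ k := by
    rw [← HomologicalComplex.homologyπ_naturality, ← HomologicalComplex.homologyπ_naturality]
    exact congrArg ((singularChains R X).homologyπ k ≫ ·) h
  have h2 : (singularChains R P.fst).homologyπ k
        (HomologicalComplex.cyclesMap (singularChainsMap R f) k z) =
      (singularChains R P.fst).homologyπ k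
        (HomologicalComplex.cyclesMap (singularChainsMap R g) k z) := congr($h1 z)
  rw [relativeClass, relativeClass, h2]

end RelativeClass

/-! ### Continuous families of `H¹` functions on the unit interval -/

section Families

/-- Lebesgue measure on `[0,1]`. -/
abbrev unitMeasure : Measure ℝ := volume.restrict (Set.Icc (0 : ℝ) 1)

lemma abs_IccExtend_le_norm (c : C(I, ℝ)) (t : ℝ) :
    |Set.IccExtend (zero_le_one' ℝ) c t| ≤ ‖c‖ :=
  c.norm_coe_le_norm _

lemma continuous_IccExtend (c : C(I, ℝ)) : Continuous (Set.IccExtend (zero_le_one' ℝ) c) :=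
  c.continuous.Icc_extend'

lemma memLp_IccExtend_mul (c : C(I, ℝ)) {h : ℝ → ℝ} (hh : MemLp h 2 unitMeasure) :
    MemLp (fun t => Set.IccExtend (zero_le_one' ℝ) c t * h t) 2 unitMeasure := by
  refine hh.of_le_mul (c := ‖c‖)
    ((continuous_IccExtend c).aestronglyMeasurable.mul hh.aestronglyMeasurable)
    (Filter.Eventually.of_forall fun t => ?_)
  rw [norm_mul]
  gcongr
  exact abs_IccExtend_le_norm c t

/-- Multiplication of square integrable functions on `[0,1]` by continuous functions. -/
def continuousMulL2 : C(I, ℝ) →L[ℝ] Lp ℝ 2 unitMeasure →L[ℝ] Lp ℝ 2 unitMeasure :=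
  LinearMap.mkContinuous₂
    (LinearMap.mk₂ ℝ (fun (c : C(I, ℝ)) (h : Lp ℝ 2 unitMeasure) => (memLp_IccExtend_mul c (Lp.memLp h)).toLp _)
      (fun c d h => by
        rw [← MemLp.toLp_add]
        exact MemLp.toLp_congr _ _ (Filter.Eventually.of_forall fun t => add_mul _ _ _))
      (fun r c h => by
        rw [← MemLp.toLp_const_smul]
        exact MemLp.toLp_congr _ _ (Filter.Eventually.of_forall fun t => mul_assoc _ _ _))
      (fun c h k => by
        rw [← MemLp.toLp_add]
        refine MemLp.toLp_congr _ _ ?_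
        filter_upwards [Lp.coeFn_add h k] with t ht
        simp only [ht, Pi.add_apply, mul_add])
      (fun r c h => by
        rw [← MemLp.toLp_const_smul]
        refine MemLp.toLp_congr _ _ ?_
        filter_upwards [Lp.coeFn_smul r h] with t ht
        simp only [ht, Pi.smul_apply, smul_eq_mul, mul_left_comm])) 1
    (fun c h => by
      rw [one_mul]
      refine Lp.norm_le_mul_norm_of_ae_le_mul ?_
      filter_upwards [(memLp_IccExtend_mul c (Lp.memLp h)).coeFn_toLp] with t ht
      rw [LinearMap.mk₂_apply, ht, norm_mul]
      gcongr
      exact abs_IccExtend_le_norm c t)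

lemma continuousMulL2_toLp (c : C(I, ℝ)) {h : ℝ → ℝ} (hh : MemLp h 2 unitMeasure) :
    continuousMulL2 c (hh.toLp h) = (memLp_IccExtend_mul c hh).toLp _ := by
  refine MemLp.toLp_congr (memLp_IccExtend_mul c (Lp.memLp (hh.toLp h))) _ ?_
  filter_upwards [hh.coeFn_toLp] with t ht
  rw [ht]

/-- A continuous family of real valued functions on `[0,1]` of class `H¹`. -/
structure IsH1Family {X : Type*} [TopologicalSpace X] (b : X → C(I, ℝ)) : Prop where
  continuous : Continuous b
  absolutelyContinuous (x : X) :
    AbsolutelyContinuousOnInterval (Set.IccExtend (zero_le_one' ℝ) (b x)) 0 1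
  memLp_deriv (x : X) : MemLp (deriv (Set.IccExtend (zero_le_one' ℝ) (b x))) 2 unitMeasure
  continuous_deriv : Continuous fun x => (memLp_deriv x).toLp _

namespace IsH1Family

variable {X Y : Type*} [TopologicalSpace X] [TopologicalSpace Y]

lemma comp_continuous {b : X → C(I, ℝ)} (hb : IsH1Family b) {h : Y → X} (hh : Continuous h) :
    IsH1Family fun y => b (h y) where
  continuous := hb.continuous.comp hh
  absolutelyContinuous y := hb.absolutelyContinuous (h y)
  memLp_deriv y := hb.memLp_deriv (h y)
  continuous_deriv := hb.continuous_deriv.comp hh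

lemma const {s : X → ℝ} (hs : Continuous s) : IsH1Family fun x => ContinuousMap.const I (s x) := by
  have h (x : X) : Set.IccExtend (zero_le_one' ℝ) (ContinuousMap.const I (s x)) = fun _ => s x := rfl
  have h0 (x : X) : MemLp (deriv (Set.IccExtend (zero_le_one' ℝ) (ContinuousMap.const I (s x)))) 2 unitMeasure := by
    rw [h]
    simp
  refine ⟨ContinuousMap.const'.continuous.comp hs, fun x => ?_, h0, ?_⟩
  · rw [h]
    exact contDiffOn_const.absolutelyContinuousOnInterval
  · refine continuous_const (y := (0 : Lp ℝ 2 unitMeasure)) |>.congr fun x => Eq.symm ?_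
    rw [Lp.eq_zero_iff_ae_eq_zero]
    refine (MemLp.coeFn_toLp _).trans (Filter.Eventually.of_forall fun t => ?_)
    exact deriv_const t (s x)

lemma coe : IsH1Family fun _ : X => (⟨Subtype.val, continuous_subtype_val⟩ : C(I, ℝ)) := by
  have h : LipschitzWith 1 (Set.IccExtend (zero_le_one' ℝ) (Subtype.val : I → ℝ)) :=
    LipschitzWith.projIcc (zero_le_one' ℝ)
  have h2 : MemLp (deriv (Set.IccExtend (zero_le_one' ℝ) (Subtype.val : I → ℝ))) 2 unitMeasure :=
    MemLp.of_bound (aestronglyMeasurable_deriv _ _) 1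
      (Filter.Eventually.of_forall fun t => norm_deriv_le_of_lipschitz h)
  exact ⟨continuous_const, fun x => h.lipschitzOnWith.absolutelyContinuousOnInterval,
    fun _ => h2, continuous_const (y := h2.toLp _)⟩

end IsH1Family

/-- The curve stays in a closed ball, where `Γ` is Lipschitz; the variation sums of the composite
are bounded by the Lipschitz constant times those of the components. -/
lemma absolutelyContinuousOnInterval_comp {ι : Type*} [Fintype ι] {Γ : (ι → ℝ) → ℝ}
    (hΓ : ContDiff ℝ 1 Γ) {a b : ℝ} {u : ι → ℝ → ℝ}
    (hu : ∀ i, AbsolutelyContinuousOnInterval (u i) a b) :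
    AbsolutelyContinuousOnInterval (fun t => Γ fun i => u i t) a b := by
  have hcont : ContinuousOn (fun t i => u i t) (Set.uIcc a b) :=
    continuousOn_pi.2 fun i => (hu i).continuousOn
  obtain ⟨r, hr⟩ := (isCompact_uIcc.image_of_continuousOn hcont).isBounded.subset_closedBall 0
  obtain ⟨K, hK⟩ := (hΓ.contDiffOn (s := Metric.closedBall 0 r)).exists_lipschitzOnWith one_ne_zero
    (convex_closedBall _ _) (isCompact_closedBall _ _)
  have hsum := (tendsto_finsetSum Finset.univ fun i _ => hu i).const_mul (K : ℝ)
  rw [Finset.sum_const_zero, mul_zero] at hsum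
  refine squeeze_zero' (Filter.Eventually.of_forall fun E => Finset.sum_nonneg fun _ _ => dist_nonneg)
    ?_ hsum
  refine Filter.Eventually.filter_mono inf_le_right (Filter.eventually_principal.2 fun E hE => ?_)
  rw [Finset.sum_comm, Finset.mul_sum]
  refine Finset.sum_le_sum fun j hj => ?_
  have hmem (t) (ht : t ∈ Set.uIcc a b) : (fun i => u i t) ∈ Metric.closedBall (0 : ι → ℝ) r :=
    hr ⟨t, ht, rfl⟩
  refine (hK.dist_le_mul _ (hmem _ (hE.1 j hj).1) _ (hmem _ (hE.1 j hj).2)).trans ?_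
  gcongr
  refine (dist_pi_le_iff (Finset.sum_nonneg fun _ _ => dist_nonneg)).2 fun i => ?_
  exact Finset.single_le_sum (f := fun i => dist (u i (E.2 j).1) (u i (E.2 j).2))
    (fun _ _ => dist_nonneg) (Finset.mem_univ i)

/-- The composition of a finite family of real functions on `[0,1]` with a function of several
variables. -/
def compCurves {ι : Type*} {Γ : (ι → ℝ) → ℝ} (hΓ : Continuous Γ) (b : ι → C(I, ℝ)) : C(I, ℝ) :=
  ⟨fun t => Γ fun i => b i t, by fun_prop⟩

lemma continuous_compCurves {X ι : Type*} [TopologicalSpace X] {Γ : (ι → ℝ) → ℝ}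
    (hΓ : Continuous Γ) {b : ι → X → C(I, ℝ)} (hb : ∀ i, Continuous (b i)) :
    Continuous fun x => compCurves hΓ fun i => b i x := by
  refine ContinuousMap.continuous_of_continuous_uncurry _ ?_
  have (i : ι) : Continuous fun p : X × I => b i p.1 p.2 :=
    ContinuousEval.continuous_eval.comp (((hb i).comp continuous_fst).prodMk continuous_snd)
  exact hΓ.comp (continuous_pi this)

/-- Almost everywhere the derivative is `∑ (∂ᵢΓ ∘ b) bᵢ'`. The first factors vary continuously in
the sup norm, the second in `L²`, and the product of the two is jointly continuous into `L²`. -/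
lemma IsH1Family.comp_contDiff {X ι : Type*} [TopologicalSpace X] [Fintype ι] {Γ : (ι → ℝ) → ℝ}
    (hΓ : ContDiff ℝ 1 Γ) {b : ι → X → C(I, ℝ)} (hb : ∀ i, IsH1Family (b i)) :
    IsH1Family fun x => compCurves hΓ.continuous fun i => b i x := by
  classical
  have hd (i : ι) : Continuous fun p => fderiv ℝ Γ p (Pi.single i 1) :=
    (hΓ.continuous_fderiv one_ne_zero).clm_apply continuous_const
  let c (i : ι) (x : X) : C(I, ℝ) := compCurves (hd i) fun j => b j x
  have hderiv (x : X) : (fun t => ∑ i, Set.IccExtend (zero_le_one' ℝ) (c i x) t *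
      deriv (Set.IccExtend (zero_le_one' ℝ) (b i x)) t) =ᵐ[unitMeasure]
      deriv (Set.IccExtend (zero_le_one' ℝ) (compCurves hΓ.continuous fun i => b i x)) := by
    have hdiff : ∀ᵐ t ∂unitMeasure, ∀ i, DifferentiableAt ℝ (Set.IccExtend (zero_le_one' ℝ) (b i x)) t := by
      rw [Filter.eventually_all]
      intro i
      have := ((hb i).absolutelyContinuous x).ae_differentiableAt
      rw [Set.uIcc_of_le zero_le_one] at this
      exact (ae_restrict_iff' measurableSet_Icc).2 this
    filter_upwards [hdiff] with t ht
    have h1 : HasDerivAt (fun t i => Set.IccExtend (zero_le_one' ℝ) (b i x) t)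
        (fun i => deriv (Set.IccExtend (zero_le_one' ℝ) (b i x)) t) t :=
      hasDerivAt_pi.2 fun i => (ht i).hasDerivAt
    have h2 := ((hΓ.differentiable one_ne_zero _).hasFDerivAt.comp_hasDerivAt t h1).deriv
    refine Eq.trans ?_ h2.symm
    refine Eq.trans ?_ (LinearMap.pi_apply_eq_sum_univ (fderiv ℝ Γ _).toLinearMap _).symm
    refine Finset.sum_congr rfl fun i _ => ?_
    rw [smul_eq_mul, mul_comm]
    refine congrArg (_ * ·) (congrArg (fderiv ℝ Γ _) (funext fun j => ?_))
    simp [Pi.single_apply, eq_comm]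
  have hmem (x : X) (i : ι) := memLp_IccExtend_mul (c i x) ((hb i).memLp_deriv x)
  have hmemsum (x : X) := memLp_finsetSum Finset.univ fun i _ => hmem x i
  have hLp (x : X) := (hmemsum x).ae_eq (hderiv x)
  refine ⟨continuous_compCurves _ fun i => (hb i).continuous, fun x =>
    absolutelyContinuousOnInterval_comp hΓ fun i => (hb i).absolutelyContinuous x, hLp, ?_⟩
  have hcont : Continuous fun x => ∑ i, continuousMulL2 (c i x) (((hb i).memLp_deriv x).toLp _) :=
    continuous_finsetSum _ fun i _ =>
      (continuousMulL2.continuous.comp (continuous_compCurves (hd i) fun j => (hb j).continuous)).clm_apply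
        (hb i).continuous_deriv
  refine hcont.congr fun x => ?_
  rw [← (hmemsum x).toLp_congr (hLp x) (hderiv x)]
  simp only [continuousMulL2_toLp]
  refine Lp.ext ?_
  refine (Lp.coeFn_finsetSum _ _).trans ?_
  refine Filter.EventuallyEq.trans ?_ (hmemsum x).coeFn_toLp.symm
  have : ∀ᵐ t ∂unitMeasure, ∀ i, (hmem x i).toLp _ t = _ := Filter.eventually_all.2 fun i => (hmem x i).coeFn_toLp
  filter_upwards [this] with t ht
  simp only [Finset.sum_apply]
  exact Finset.sum_congr rfl fun i _ => ht i

end Families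

/-! ### Smooth functions detect points, topology and `H¹` families -/

section SmoothFunctions

variable {m : ℕ} {M : Type u} [TopologicalSpace M] [ChartedSpace (EuclideanSpace ℝ (Fin m)) M]

/-- The composition of a curve with a smooth function. -/
def smoothComp (f : C^∞⟮𝓡 m, M; 𝓘(ℝ), ℝ⟯) (c : C(I, M)) : C(I, ℝ) :=
  (⟨f, f.contMDiff.continuous⟩ : C(M, ℝ)).comp c

lemma FreeLoop.isH1Family (f : C^∞⟮𝓡 m, M; 𝓘(ℝ), ℝ⟯) :
    IsH1Family fun γ : FreeLoop m M => smoothComp f γ.curve where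
  continuous := (ContinuousMap.continuous_postcomp _).comp FreeLoop.continuous_curve
  absolutelyContinuous γ := γ.2.2.absolutelyContinuous f
  memLp_deriv γ := γ.2.2.memLp_deriv f
  continuous_deriv := FreeLoop.continuous_derivAlong f

/-- A continuous family of closed curves gives a continuous map to the loop space as soon as its
compositions with smooth functions are continuous families of class `H¹`. -/
def FreeLoop.ofFamily {X : Type*} [TopologicalSpace X] (c : X → C(I, M))
    (hcl : ∀ x, c x 0 = c x 1) (hc : Continuous c)
    (h : ∀ f : C^∞⟮𝓡 m, M; 𝓘(ℝ), ℝ⟯, IsH1Family fun x => smoothComp f (c x)) :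
    C(X, FreeLoop m M) where
  toFun x := ⟨c x, hcl x, fun f => (h f).absolutelyContinuous x, fun f => (h f).memLp_deriv x⟩
  continuous_toFun := (FreeLoop.continuous_iff _).2 ⟨hc, fun f => (h f).continuous_deriv⟩

variable [T2Space M] [CompactSpace M] [IsManifold (𝓡 m) ∞ M]

variable (m M) in
lemma exists_isEmbedding_smooth : ∃ (d : ℕ) (e : Fin d → C^∞⟮𝓡 m, M; 𝓘(ℝ), ℝ⟯),
    Topology.IsEmbedding fun x i => e i x := by
  obtain ⟨d, e, he, hemb, -⟩ : ∃ (d : ℕ) (e : M → EuclideanSpace ℝ (Fin d)),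
      ContMDiff (𝓡 m) (𝓡 d) ∞ e ∧ Topology.IsClosedEmbedding e ∧
        ∀ x, Function.Injective (mfderiv (𝓡 m) (𝓡 d) e x) :=
    exists_embedding_euclidean_of_compact
  refine ⟨d, fun i => ⟨fun x => e x i, ?_⟩, ?_⟩
  · exact (contDiff_euclidean.1 contDiff_id i).contMDiff.comp he
  · exact (PiLp.homeomorph 2 fun _ : Fin d => ℝ).isEmbedding.comp hemb.isEmbedding

lemma continuous_of_smooth_comp {X : Type*} [TopologicalSpace X] {h : X → M}
    (H : ∀ f : C^∞⟮𝓡 m, M; 𝓘(ℝ), ℝ⟯, Continuous fun x => f (h x)) : Continuous h := by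
  obtain ⟨d, e, he⟩ := exists_isEmbedding_smooth m M
  exact he.continuous_iff.2 (continuous_pi fun i => H (e i))

lemma eq_of_forall_smooth_eq {x y : M} (H : ∀ f : C^∞⟮𝓡 m, M; 𝓘(ℝ), ℝ⟯, f x = f y) : x = y := by
  obtain ⟨d, e, he⟩ := exists_isEmbedding_smooth m M
  exact he.injective (funext fun i => H (e i))

end SmoothFunctions

/-! ### Smooth families of self-maps and the induced homotopy of loops -/

section SmoothFamilies

variable {m : ℕ} {M : Type u} [TopologicalSpace M] [ChartedSpace (EuclideanSpace ℝ (Fin m)) M]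

variable (m) in
/-- A one-parameter family of self-maps of `M` such that every smooth function composed with it is
a smooth function of the parameter and of finitely many smooth functions on `M`. -/
def IsSmoothFamily (F : ℝ → M → M) : Prop :=
  ∀ f : C^∞⟮𝓡 m, M; 𝓘(ℝ), ℝ⟯, ∃ (ι : Type) (_ : Fintype ι) (U : ι → C^∞⟮𝓡 m, M; 𝓘(ℝ), ℝ⟯)
    (Γ : ℝ × (ι → ℝ) → ℝ), ContDiff ℝ ∞ Γ ∧ ∀ τ x, f (F τ x) = Γ (τ, fun i => U i x)

namespace IsSmoothFamily

lemma refl : IsSmoothFamily m fun _ (x : M) => x := fun f =>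
  ⟨Unit, inferInstance, fun _ => f, fun y => y.2 (), by fun_prop, fun _ _ => rfl⟩

lemma comp {F G : ℝ → M → M} (hF : IsSmoothFamily m F) (hG : IsSmoothFamily m G) :
    IsSmoothFamily m fun τ x => F τ (G τ x) := by
  intro f
  obtain ⟨ι, _, U, Γ, hΓ, h⟩ := hF f
  choose κ _ V Δ hΔ h' using fun i => hG (U i)
  refine ⟨Σ i, κ i, inferInstance, fun j => V j.1 j.2,
    fun y => Γ (y.1, fun i => Δ i (y.1, fun k => y.2 ⟨i, k⟩)), ?_, fun τ x => ?_⟩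
  · refine hΓ.comp (contDiff_fst.prodMk (contDiff_pi.2 fun i => (hΔ i).comp ?_))
    fun_prop
  · simp only [h, h']

lemma continuous_uncurry [T2Space M] [CompactSpace M] [IsManifold (𝓡 m) ∞ M] {F : ℝ → M → M}
    (hF : IsSmoothFamily m F) : Continuous fun p : ℝ × M => F p.1 p.2 := by
  refine continuous_of_smooth_comp (m := m) fun f => ?_
  obtain ⟨ι, _, U, Γ, hΓ, h⟩ := hF f
  simp only [h]
  refine hΓ.continuous.comp (continuous_fst.prodMk (continuous_pi fun i => ?_))
  exact (U i).contMDiff.continuous.comp continuous_snd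

/-- The homotopy of the loop space which moves `γ(t)` along the family for the time
`s δ t (1 - t)`. -/
lemma exists_loop_homotopy [T2Space M] [CompactSpace M] [IsManifold (𝓡 m) ∞ M] {F : ℝ → M → M}
    (hF : IsSmoothFamily m F) (h0 : ∀ x, F 0 x = x) (δ : ℝ) :
    ∃ H : C(I × FreeLoop m M, FreeLoop m M), ∀ (s : I) (γ : FreeLoop m M) (t : I),
      (H (s, γ)).curve t = F (s * δ * (t * (1 - t))) (γ.curve t) := by
  have hcurve : Continuous fun p : (I × FreeLoop m M) × I => p.1.2.curve p.2 :=
    ContinuousEval.continuous_eval.comp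
      ((FreeLoop.continuous_curve.comp (continuous_snd.comp continuous_fst)).prodMk continuous_snd)
  have hcont : Continuous fun p : (I × FreeLoop m M) × I =>
      F (p.1.1 * δ * (p.2 * (1 - p.2))) (p.1.2.curve p.2) :=
    hF.continuous_uncurry.comp (Continuous.prodMk (by fun_prop) hcurve)
  let c : C(I × FreeLoop m M, C(I, M)) := ContinuousMap.curry ⟨_, hcont⟩
  have hc (s : I) (γ : FreeLoop m M) (t : I) :
      c (s, γ) t = F (s * δ * (t * (1 - t))) (γ.curve t) := rfl
  refine ⟨FreeLoop.ofFamily c ?_ c.continuous fun f => ?_, fun s γ t => rfl⟩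
  -- The time `s δ t (1 - t)` vanishes at both ends, so the endpoints do not move and the curve
  -- stays closed.
  · rintro ⟨s, γ⟩
    simp only [hc, Set.Icc.coe_zero, Set.Icc.coe_one, sub_zero, sub_self, zero_mul,
      mul_zero, h0]
    exact γ.2.1
  · obtain ⟨ι, _, U, Γ, hΓ, h⟩ := hF f
    -- The extra two variables are the homotopy parameter and the curve parameter, themselves `H¹`
    -- families.
    let Γ' : (Fin 2 ⊕ ι → ℝ) → ℝ := fun y =>
      Γ (y (.inl 0) * δ * (y (.inl 1) * (1 - y (.inl 1))), fun i => y (.inr i))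
    have hΓ' : ContDiff ℝ 1 Γ' := (hΓ.of_le (by simp)).comp (by fun_prop)
    let b : Fin 2 ⊕ ι → I × FreeLoop m M → C(I, ℝ) := Sum.elim
      ![fun x => ContinuousMap.const I (x.1 : ℝ), fun _ => ⟨Subtype.val, continuous_subtype_val⟩]
      fun i x => smoothComp (U i) x.2.curve
    have hb (i) : IsH1Family (b i) := by
      rcases i with i | i
      · fin_cases i
        · exact IsH1Family.const (continuous_subtype_val.comp continuous_fst)
        · exact IsH1Family.coe
      · exact (FreeLoop.isH1Family (U i)).comp_continuous continuous_snd
    convert IsH1Family.comp_contDiff hΓ' hb using 2 with x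
    ext t
    exact h _ _

end IsSmoothFamily

end SmoothFamilies

/-! ### Initial velocities -/

section Velocity

variable {m : ℕ} {M : Type u} [TopologicalSpace M] [ChartedSpace (EuclideanSpace ℝ (Fin m)) M]

/-- The differential of a smooth function at a point. -/
def smoothDeriv (f : C^∞⟮𝓡 m, M; 𝓘(ℝ), ℝ⟯) (x : M) : TangentSpace (𝓡 m) x →L[ℝ] ℝ :=
  mfderiv (𝓡 m) 𝓘(ℝ) f x

/-- The family `F` moves the point `x` with initial velocity `v x`. -/
def HasInitialVelocity (F : ℝ → M → M) (v : ∀ x : M, TangentSpace (𝓡 m) x) : Prop :=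
  ∀ (f : C^∞⟮𝓡 m, M; 𝓘(ℝ), ℝ⟯) (x : M),
    HasDerivAt (fun τ => f (F τ x)) (smoothDeriv f x (v x)) 0

lemma hasInitialVelocity_refl :
    HasInitialVelocity (fun _ (x : M) => x) (fun x => (0 : TangentSpace (𝓡 m) x)) := fun f x => by
  rw [map_zero]
  exact hasDerivAt_const _ _

/-- Write `f (F τ (G τ x))` as `Γ(τ, U (G τ x))`. Its derivative at `0` splits linearly: varying
only the first slot gives the velocity of `F`, as `G 0 = id`; varying only the second gives that of
`G`, as `F 0 = id`. -/
lemma HasInitialVelocity.comp {F G : ℝ → M → M} {v w : ∀ x : M, TangentSpace (𝓡 m) x}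
    (hF : HasInitialVelocity F v) (hG : HasInitialVelocity G w) (hFs : IsSmoothFamily m F)
    (hF0 : ∀ x, F 0 x = x) (hG0 : ∀ x, G 0 x = x) :
    HasInitialVelocity (fun τ x => F τ (G τ x)) (fun x => v x + w x) := by
  intro f x
  obtain ⟨ι, _, U, Γ, hΓ, h⟩ := hFs f
  have hΓd : HasFDerivAt Γ (fderiv ℝ Γ (0, fun i => U i x)) (0, fun i => U i x) :=
    (hΓ.differentiable (by simp) _).hasFDerivAt
  have hU : HasDerivAt (fun τ i => U i (G τ x))
      (fun i => smoothDeriv (U i) x (w x)) 0 :=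
    hasDerivAt_pi.2 fun i => hG (U i) x
  have hG0' : (fun i => U i (G 0 x)) = fun i => U i x := by rw [hG0]
  have h1 : HasDerivAt (fun τ : ℝ => Γ (τ, fun i => U i x)) _ 0 :=
    HasFDerivAt.comp_hasDerivAt (l := Γ) (f := fun τ : ℝ => (τ, fun i => U i x)) 0 hΓd
      ((hasDerivAt_id 0).prodMk (hasDerivAt_const _ _))
  have h2 : HasDerivAt (fun τ : ℝ => Γ (0, fun i => U i (G τ x))) _ 0 :=
    HasFDerivAt.comp_hasDerivAt (l := Γ) (f := fun τ : ℝ => ((0 : ℝ), fun i => U i (G τ x))) 0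
      (by simpa only [hG0'] using hΓd) ((hasDerivAt_const _ _).prodMk hU)
  have h3 : HasDerivAt (fun τ : ℝ => Γ (τ, fun i => U i (G τ x))) _ 0 :=
    HasFDerivAt.comp_hasDerivAt (l := Γ) (f := fun τ : ℝ => (τ, fun i => U i (G τ x))) 0
      (by simpa only [hG0'] using hΓd) ((hasDerivAt_id 0).prodMk hU)
  have e1 := h1.unique (by simpa only [h] using hF f x)
  have e2 := h2.unique (by simpa only [← h, hF0] using hG f x)
  simp only [h]
  refine h3.congr_deriv (Eq.symm ?_)
  rw [map_add]
  refine (congrArg₂ (· + ·) e1.symm e2.symm).trans ?_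
  rw [← map_add]
  simp

end Velocity

/-! ### Pushing points inside one chart -/

section LocalPush

open Metric

variable {m : ℕ} {M : Type u} [TopologicalSpace M] [ChartedSpace (EuclideanSpace ℝ (Fin m)) M]

/-- The support of the bump lies in the chart target, so the product is smooth there and locally
zero elsewhere. -/
lemma contDiff_contDiffBump_mul_comp_extChartAt_symm [IsManifold (𝓡 m) ∞ M] {x₀ : M}
    (B : ContDiffBump (extChartAt (𝓡 m) x₀ x₀))
    (hB : closedBall (extChartAt (𝓡 m) x₀ x₀) B.rOut ⊆ (extChartAt (𝓡 m) x₀).target)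
    (f : C^∞⟮𝓡 m, M; 𝓘(ℝ), ℝ⟯) :
    ContDiff ℝ ∞ fun y => B y * f ((extChartAt (𝓡 m) x₀).symm y) := by
  rw [contDiff_iff_contDiffAt]
  intro y
  by_cases hy : y ∈ (extChartAt (𝓡 m) x₀).target
  · refine B.contDiffAt.mul (contMDiffAt_iff_contDiffAt.1 ?_)
    exact f.contMDiff.contMDiffAt.comp y
      ((contMDiffOn_extChartAt_symm x₀).contMDiffAt ((isOpen_extChartAt_target x₀).mem_nhds hy))
  · have hy' : y ∉ tsupport B := fun h => hy (hB (B.tsupport_eq ▸ h))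
    refine (contDiffAt_const (c := (0 : ℝ))).congr_of_eventuallyEq ?_
    filter_upwards [notMem_tsupport_iff_eventuallyEq.1 hy'] with z hz
    rw [hz, Pi.zero_apply, zero_mul]

/-- The family which near `x₀` moves points in the direction `w` of the chart at `x₀`. -/
def chartPush (x₀ : M) (χ : M → ℝ) (w : EuclideanSpace ℝ (Fin m)) (τ : ℝ) (x : M) : M :=
  open scoped Classical in
  if x ∈ (chartAt (EuclideanSpace ℝ (Fin m)) x₀).source then
    -- `sin τ` replaces `τ`: it has derivative `1` at `0` and is bounded, so for small `w` the moved
    -- point stays in the chart for every `τ`.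
    (extChartAt (𝓡 m) x₀).symm (extChartAt (𝓡 m) x₀ x + (Real.sin τ * χ x) • w)
  else x

lemma chartPush_of_eq_zero {x₀ : M} {χ : M → ℝ} {w : EuclideanSpace ℝ (Fin m)} {τ : ℝ} {x : M}
    (h : Real.sin τ * χ x = 0) : chartPush x₀ χ w τ x = x := by
  unfold chartPush
  split_ifs with hx
  · rw [h, zero_smul, add_zero, (extChartAt (𝓡 m) x₀).left_inv (by simpa using hx)]
  · rfl

variable [IsManifold (𝓡 m) ∞ M]

/-- The identity is `f (push x) = f x + κ x * G τ (β x • chart x)`, with nested cutoffs: `χ` is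
supported within `r/8`, `κ` is `1` up to `r/8` and supported within `r/4`, `β` is `1` up to `r/4`,
and `B` is `1` up to `r/2`, which contains the moved points since `r/8 + r/4 ≤ r/2`. -/
lemma isSmoothFamily_chartPush [T2Space M] {x₀ : M} (b : SmoothBumpFunction (𝓡 m) x₀)
    {χ : SmoothBumpFunction (𝓡 m) x₀} (hχ : χ.rOut = b.rOut / 8) {w : EuclideanSpace ℝ (Fin m)}
    (hw : ‖w‖ ≤ b.rOut / 4) : IsSmoothFamily m (chartPush x₀ χ w) := by
  intro f
  have hr := b.rOut_pos
  set r := b.rOut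
  set y₀ := extChartAt (𝓡 m) x₀ x₀ with hy₀
  have htarget : closedBall y₀ r ⊆ (extChartAt (𝓡 m) x₀).target := by
    simpa only [ModelWithCorners.range_eq_univ, Set.inter_univ] using b.closedBall_subset
  let mk (s t : ℝ) (hs : 0 < s) (hst : s < t) (ht : t ≤ r) : SmoothBumpFunction (𝓡 m) x₀ :=
    ⟨⟨s, t, hs, hst⟩,
      Set.inter_subset_left.trans ((closedBall_subset_closedBall ht).trans htarget)⟩
  let β := mk (r / 4) (r / 2) (by linarith) (by linarith) (by linarith)
  let κ := mk (r / 8) (r / 4) (by linarith) (by linarith) (by linarith)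
  let B : ContDiffBump y₀ := ⟨r / 2, r, by linarith, by linarith⟩
  let fhat : EuclideanSpace ℝ (Fin m) → ℝ := fun y => B y * f ((extChartAt (𝓡 m) x₀).symm y)
  have hfhat : ContDiff ℝ ∞ fhat := contDiff_contDiffBump_mul_comp_extChartAt_symm B htarget f
  let G : ℝ → EuclideanSpace ℝ (Fin m) → ℝ := fun τ y =>
    fhat (y + (Real.sin τ * χ.toContDiffBump y) • w) - fhat y
  have hχs : ContDiff ℝ ∞ χ.toContDiffBump := χ.contDiff
  have hu := β.contMDiff_smul (contMDiffOn_extChartAt :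
    ContMDiffOn (𝓡 m) 𝓘(ℝ, EuclideanSpace ℝ (Fin m)) ∞ (extChartAt (𝓡 m) x₀)
      (chartAt (EuclideanSpace ℝ (Fin m)) x₀).source)
  let u (j : Fin m) : C^∞⟮𝓡 m, M; 𝓘(ℝ), ℝ⟯ :=
    ⟨fun x => (β x • extChartAt (𝓡 m) x₀ x) j, (contDiff_euclidean.1 contDiff_id j).contMDiff.comp hu⟩
  refine ⟨Fin 2 ⊕ Fin m, inferInstance, Sum.elim ![f, ⟨κ, κ.contMDiff⟩] u,
    fun p => p.2 (.inl 0) + p.2 (.inl 1) * G p.1 (WithLp.toLp 2 fun j => p.2 (.inr j)), ?_,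
    fun τ x => ?_⟩
  · have hL : ContDiff ℝ ∞ fun p : ℝ × (Fin 2 ⊕ Fin m → ℝ) =>
        (WithLp.toLp 2 fun j => p.2 (.inr j) : EuclideanSpace ℝ (Fin m)) :=
      contDiff_euclidean.2 fun j => by fun_prop
    have hsin : ContDiff ℝ ∞ fun p : ℝ × (Fin 2 ⊕ Fin m → ℝ) => Real.sin p.1 :=
      Real.contDiff_sin.comp contDiff_fst
    have hG : ContDiff ℝ ∞ fun p : ℝ × (Fin 2 ⊕ Fin m → ℝ) =>
        G p.1 (WithLp.toLp 2 fun j => p.2 (.inr j)) :=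
      (hfhat.comp (hL.add ((hsin.mul (hχs.comp hL)).smul contDiff_const))).sub (hfhat.comp hL)
    exact ContDiff.add (by fun_prop) (ContDiff.mul (by fun_prop) hG)
  · change f (chartPush x₀ χ w τ x) = f x + κ x * G τ (β x • extChartAt (𝓡 m) x₀ x)
    by_cases hx : x ∈ (chartAt (EuclideanSpace ℝ (Fin m)) x₀).source
    · set y := extChartAt (𝓡 m) x₀ x with hy
      have hxy : (extChartAt (𝓡 m) x₀).symm y = x := (extChartAt (𝓡 m) x₀).left_inv (by simpa using hx)
      have hχx : χ x = χ.toContDiffBump y := χ.eqOn_source hx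
      rcases le_or_gt (dist y y₀) (r / 8) with h8 | h8
      · rw [κ.one_of_dist_le hx h8, β.one_of_dist_le hx (h8.trans (by change _ ≤ r / 4; linarith)),
          one_smul, one_mul]
        have hB1 : B y = 1 := B.one_of_mem_closedBall (h8.trans (by change _ ≤ r / 2; linarith))
        have hB2 : B (y + (Real.sin τ * χ.toContDiffBump y) • w) = 1 := by
          refine B.one_of_mem_closedBall ?_
          have hsc : |Real.sin τ * χ.toContDiffBump y| ≤ 1 := by
            rw [abs_mul, abs_of_nonneg (χ.toContDiffBump.nonneg' y)]
            exact mul_le_one₀ (Real.abs_sin_le_one τ) (χ.toContDiffBump.nonneg' y) χ.toContDiffBump.le_one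
          have h1 : ‖(Real.sin τ * χ.toContDiffBump y) • w‖ ≤ r / 4 := by
            rw [norm_smul]
            exact (mul_le_of_le_one_left (norm_nonneg _) hsc).trans hw
          rw [mem_closedBall]
          calc dist (y + (Real.sin τ * χ.toContDiffBump y) • w) y₀
              ≤ dist (y + (Real.sin τ * χ.toContDiffBump y) • w) y + dist y y₀ := dist_triangle _ _ _
            _ ≤ r / 4 + r / 8 := by
                gcongr
                simpa [dist_eq_norm] using h1
            _ ≤ r / 2 := by linarith
        simp only [G, fhat, hB1, hB2, hxy, one_mul]
        unfold chartPush
        rw [if_pos hx, hχx]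
        ring
      -- Beyond `r/8` nothing moves. Up to `r/4` the coordinates are still exact and `G` vanishes;
      -- further out `β` may distort them, but `κ` vanishes.
      · have hχ0 : χ.toContDiffBump y = 0 := χ.toContDiffBump.zero_of_le_dist (hχ ▸ h8.le)
        rw [chartPush_of_eq_zero (by rw [hχx, hχ0, mul_zero])]
        rcases le_or_gt (dist y y₀) (r / 4) with h4 | h4
        · rw [β.one_of_dist_le hx h4, one_smul]
          have : G τ y = 0 := by simp only [G, hχ0, mul_zero, zero_smul, add_zero, sub_self]
          rw [this, mul_zero, add_zero]
        · have : κ x = 0 := (κ.eqOn_source hx).trans (κ.toContDiffBump.zero_of_le_dist h4.le)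
          rw [this, zero_mul, add_zero]
    · have hnot (η : SmoothBumpFunction (𝓡 m) x₀) : η x = 0 :=
        Function.notMem_support.1 fun h => hx (η.support_subset_source h)
      rw [chartPush_of_eq_zero (by rw [hnot, mul_zero]), hnot κ, zero_mul, add_zero]

lemma hasInitialVelocity_chartPush {x₀ : M} (χ : SmoothBumpFunction (𝓡 m) x₀)
    (w : EuclideanSpace ℝ (Fin m)) :
    HasInitialVelocity (chartPush x₀ χ w) fun x =>
      χ x • (trivializationAt (EuclideanSpace ℝ (Fin m)) (TangentSpace (𝓡 m) : M → Type _) x₀).symmL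
        ℝ x w := by
  intro f x
  beta_reduce
  by_cases hx : x ∈ (chartAt (EuclideanSpace ℝ (Fin m)) x₀).source
  · have : IsManifold (𝓡 m) 1 M := IsManifold.of_le (n := ∞) (by simp)
    rw [TangentBundle.symmL_trivializationAt hx]
    set y := extChartAt (𝓡 m) x₀ x with hy
    have hxs : x ∈ (extChartAt (𝓡 m) x₀).source := by simpa using hx
    have hxy : (extChartAt (𝓡 m) x₀).symm y = x := (extChartAt (𝓡 m) x₀).left_inv hxs
    have hyt : y ∈ (extChartAt (𝓡 m) x₀).target := (extChartAt (𝓡 m) x₀).map_source hxs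
    have hsymm : MDifferentiableAt 𝓘(ℝ, EuclideanSpace ℝ (Fin m)) (𝓡 m) (extChartAt (𝓡 m) x₀).symm y :=
      ((contMDiffOn_extChartAt_symm (n := 1) x₀).contMDiffAt
        ((isOpen_extChartAt_target x₀).mem_nhds hyt)).mdifferentiableAt one_ne_zero
    -- Quantifying over `z = x` avoids transporting tangent spaces along `hxy`, which is only a
    -- propositional equality.
    have hf : ∀ z, z = x → HasMFDerivAt (𝓡 m) 𝓘(ℝ) f z
        (smoothDeriv f x : EuclideanSpace ℝ (Fin m) →L[ℝ] ℝ) := by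
      rintro _ rfl
      exact (f.contMDiff.mdifferentiableAt (by simp)).hasMFDerivAt
    let L : EuclideanSpace ℝ (Fin m) →L[ℝ] EuclideanSpace ℝ (Fin m) :=
      mfderivWithin 𝓘(ℝ, EuclideanSpace ℝ (Fin m)) (𝓡 m) (extChartAt (𝓡 m) x₀).symm
        (Set.range (𝓡 m)) y
    have hL : HasMFDerivAt 𝓘(ℝ, EuclideanSpace ℝ (Fin m)) (𝓡 m) (extChartAt (𝓡 m) x₀).symm y L := by
      have := hsymm.hasMFDerivAt
      rwa [← mfderivWithin_univ, ← (𝓡 m).range_eq_univ] at this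
    have hcomp : HasFDerivAt (f ∘ (extChartAt (𝓡 m) x₀).symm)
        ((smoothDeriv f x : EuclideanSpace ℝ (Fin m) →L[ℝ] ℝ).comp L) y :=
      ((hf _ hxy).comp y hL).hasFDerivAt
    have hcurve : HasDerivAt (fun τ => y + (Real.sin τ * χ x) • w) (χ x • w) 0 := by
      have := (((Real.hasDerivAt_sin 0).mul_const (χ x)).smul_const w).const_add y
      simpa using this
    have hy0 : y = y + (Real.sin 0 * χ x) • w := by simp
    have hcomp' := HasFDerivAt.comp_hasDerivAt (f := fun τ => y + (Real.sin τ * χ x) • w) 0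
      (hy0 ▸ hcomp) hcurve
    have hfun : (fun τ => f (chartPush x₀ χ w τ x)) =
        (f ∘ (extChartAt (𝓡 m) x₀).symm) ∘ fun τ => y + (Real.sin τ * χ x) • w := by
      funext τ
      simp only [chartPush, if_pos hx, Function.comp_apply, hy]
    rw [hfun]
    refine hcomp'.congr_deriv ?_
    rw [map_smul, map_smul]
    rfl
  · have h0 : χ x = 0 := Function.notMem_support.1 fun h => hx (χ.support_subset_source h)
    rw [h0, zero_smul, map_zero]
    have (τ : ℝ) : chartPush x₀ χ w τ x = x := chartPush_of_eq_zero (by rw [h0, mul_zero])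
    simp only [this]
    exact hasDerivAt_const _ _

end LocalPush

/-! ### A family moving `N` in the direction of the section -/

section Transversality

variable {m : ℕ}
  {M : Type u} [TopologicalSpace M] [ChartedSpace (EuclideanSpace ℝ (Fin m)) M]
  [IsManifold (𝓡 m) ∞ M]
  {N : Type u} [TopologicalSpace N]

open scoped Bundle in
lemma continuousAt_riemannianMetric_apply {X : Type*} [TopologicalSpace X] (g : RiemannianMetric m M) {b : X → M}
    {v w : ∀ x, TangentSpace (𝓡 m) (b x)} {x : X}
    (hv : ContinuousAt (fun x => (⟨b x, v x⟩ : TangentBundle (𝓡 m) M)) x)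
    (hw : ContinuousAt (fun x => (⟨b x, w x⟩ : TangentBundle (𝓡 m) M)) x) :
    ContinuousAt (fun x => g.inner (b x) (v x) (w x)) x := by
  let : Bundle.RiemannianBundle (fun p : M => TangentSpace (𝓡 m) p) :=
    ⟨g.toContinuousRiemannianMetric.toRiemannianMetric⟩
  exact ContinuousAt.inner_bundle (F := EuclideanSpace ℝ (Fin m)) hv hw

/-- A family of smooth self-maps whose initial velocity field along `φ` has positive scalar product
with a given nowhere vanishing field. -/
lemma exists_isSmoothFamily_inner_pos [T2Space M] [CompactSpace N] (g : RiemannianMetric m M) {φ : N → M}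
    (hφ : Topology.IsEmbedding φ) (s : ∀ p : N, TangentSpace (𝓡 m) (φ p))
    (hs : Continuous fun p => (⟨φ p, s p⟩ : TangentBundle (𝓡 m) M)) (hs0 : ∀ p, s p ≠ 0) :
    ∃ (F : ℝ → M → M) (v : ∀ x : M, TangentSpace (𝓡 m) x), IsSmoothFamily m F ∧ (∀ x, F 0 x = x) ∧
      HasInitialVelocity F v ∧ ∀ q, 0 < g.inner (φ q) (v (φ q)) (s q) := by
  -- Nonnegativity on all of `N` is carried along: composition adds velocities, so positivity on
  -- either of two sets survives on the union.
  let P (S : Set N) : Prop := ∃ (F : ℝ → M → M) (v : ∀ x : M, TangentSpace (𝓡 m) x),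
    IsSmoothFamily m F ∧ (∀ x, F 0 x = x) ∧ HasInitialVelocity F v ∧
      (∀ q, 0 ≤ g.inner (φ q) (v (φ q)) (s q)) ∧ ∀ q ∈ S, 0 < g.inner (φ q) (v (φ q)) (s q)
  suffices h : P Set.univ by
    obtain ⟨F, v, h1, h2, h3, -, h5⟩ := h
    exact ⟨F, v, h1, h2, h3, fun q => h5 q trivial⟩
  refine isCompact_univ.induction_on (p := P) ?_ ?_ ?_ ?_
  · exact ⟨_, _, IsSmoothFamily.refl, fun _ => rfl, hasInitialVelocity_refl, fun q => by simp,
      fun q hq => hq.elim⟩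
  · rintro S T hST ⟨F, v, h1, h2, h3, h4, h5⟩
    exact ⟨F, v, h1, h2, h3, h4, fun q hq => h5 q (hST hq)⟩
  · rintro S T ⟨F, v, h1, h2, h3, h4, h5⟩ ⟨F', v', h1', h2', h3', h4', h5'⟩
    refine ⟨_, _, h1.comp h1', fun x => by simp only [h2', h2], h3.comp h3' h1 h2 h2', fun q => ?_,
      fun q hq => ?_⟩
    · rw [map_add]
      exact add_nonneg (h4 q) (h4' q)
    · rw [map_add]
      rcases hq with hq | hq
      · exact add_pos_of_pos_of_nonneg (h5 q hq) (h4' q)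
      · exact add_pos_of_nonneg_of_pos (h4 q) (h5' q hq)
  · intro p _
    let e := trivializationAt (EuclideanSpace ℝ (Fin m)) (TangentSpace (𝓡 m) : M → Type _) (φ p)
    -- The vector `s p` is extended as a constant in the trivialization; by continuity its product
    -- with `s` stays positive near `p`.
    let w : EuclideanSpace ℝ (Fin m) := e.continuousLinearMapAt ℝ (φ p) (s p)
    have hbase : φ p ∈ e.baseSet := FiberBundle.mem_baseSet_trivializationAt' (φ p)
    have hw : e.symmL ℝ (φ p) w = s p := e.symmL_continuousLinearMapAt hbase _
    have hcont : ContinuousAt (fun q => g.inner (φ q) (e.symmL ℝ (φ q) w) (s q)) p := by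
      refine continuousAt_riemannianMetric_apply g ?_ hs.continuousAt
      have h1 : ContinuousAt (fun x : M =>
          (⟨x, e.symm x w⟩ : TangentBundle (𝓡 m) M)) (φ p) :=
        (e.continuousOn_symm.continuousAt
          ((e.open_baseSet.prod isOpen_univ).mem_nhds ⟨hbase, trivial⟩)).comp
            (f := fun x : M => (x, w)) (by fun_prop)
      have h2 : ContinuousAt (fun x : M => (⟨x, e.symmL ℝ x w⟩ : TangentBundle (𝓡 m) M)) (φ p) :=
        h1.congr (by
          filter_upwards [e.open_baseSet.mem_nhds hbase] with x hx
          rw [e.symmL_apply hx])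
      exact h2.comp (f := φ) hφ.continuous.continuousAt
    have hpos : ∀ᶠ q in 𝓝 p, 0 < g.inner (φ q) (e.symmL ℝ (φ q) w) (s q) := by
      refine hcont.eventually_const_lt ?_
      beta_reduce
      rw [hw]
      exact g.pos _ _ (hs0 p)
    -- As `φ` is an embedding, positivity holds on the preimage of a neighbourhood `O` in `M`, so a
    -- cutoff on `M` supported in `O` suffices.
    rw [hφ.nhds_eq_comap] at hpos
    obtain ⟨O, hO, hOpos⟩ := Filter.mem_comap.1 hpos
    obtain ⟨b, -, hb⟩ := (SmoothBumpFunction.nhds_basis_tsupport (φ p) :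
      (𝓝 (φ p)).HasBasis (fun _ : SmoothBumpFunction (𝓡 m) (φ p) => True) _).mem_iff.1 hO
    have hr := b.rOut_pos
    let χ : SmoothBumpFunction (𝓡 m) (φ p) := ⟨⟨b.rOut / 16, b.rOut / 8, by positivity, by linarith⟩,
      (Set.inter_subset_inter_left _ (Metric.closedBall_subset_closedBall (by
        change b.rOut / 8 ≤ _; linarith))).trans b.closedBall_subset⟩
    have hχO : ∀ x, χ x ≠ 0 → x ∈ O := fun x hx => by
      have hx' : x ∈ Function.support χ := hx
      rw [χ.support_eq_inter_preimage] at hx'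
      refine hb (subset_closure ?_)
      rw [b.support_eq_inter_preimage]
      refine ⟨hx'.1, Metric.ball_subset_ball ?_ hx'.2⟩
      change b.rOut / 8 ≤ _
      linarith
    obtain ⟨c, hc, hcw⟩ : ∃ c : ℝ, 0 < c ∧ ‖c • w‖ ≤ b.rOut / 4 := by
      refine ⟨b.rOut / 4 / (‖w‖ + 1), by positivity, ?_⟩
      rw [norm_smul, Real.norm_of_nonneg (by positivity), div_mul_eq_mul_div]
      refine div_le_of_le_mul₀ (by positivity) (by positivity) ?_
      gcongr
      linarith
    have hval (q : N) : g.inner (φ q) (χ (φ q) • e.symmL ℝ (φ q) (c • w)) (s q) =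
        χ (φ q) * (c * g.inner (φ q) (e.symmL ℝ (φ q) w) (s q)) := by
      simp only [map_smul, smul_apply, smul_eq_mul]
    refine ⟨{q | 0 < χ (φ q)}, mem_nhdsWithin_of_mem_nhds ?_, chartPush (φ p) χ (c • w), _,
      isSmoothFamily_chartPush b rfl hcw, fun x => chartPush_of_eq_zero (by simp),
      hasInitialVelocity_chartPush χ (c • w), fun q => ?_, fun q hq => ?_⟩
    · refine (χ.continuous.comp hφ.continuous).continuousAt.eventually_const_lt ?_
      rw [Function.comp_apply, χ.eq_one]
      exact one_pos
    · refine (hval q).symm ▸ ?_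
      by_cases hq : χ (φ q) = 0
      · rw [hq, zero_mul]
      · exact mul_nonneg χ.nonneg (mul_nonneg hc.le (hOpos (hχO _ hq)).le)
    · refine (hval q).symm ▸ ?_
      exact mul_pos hq (mul_pos hc (hOpos (hχO _ hq.ne')))

end Transversality

/-! ### Moving a submanifold off itself -/

section Disjoint

variable {m n : ℕ}
  {M : Type u} [TopologicalSpace M] [ChartedSpace (EuclideanSpace ℝ (Fin m)) M]
  [IsManifold (𝓡 m) ∞ M]
  {N : Type u} [TopologicalSpace N] [ChartedSpace (EuclideanSpace ℝ (Fin n)) N]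

/-- A function which is smooth on a neighbourhood of `x` has the same germ at `x` as a smooth
function on `M`. -/
lemma exists_smooth_eventuallyEq [T2Space M] {x : M} {O : Set M} (hO : IsOpen O) (hx : x ∈ O)
    {h : M → ℝ} (hh : ContMDiffOn (𝓡 m) 𝓘(ℝ) ∞ h O) :
    ∃ f : C^∞⟮𝓡 m, M; 𝓘(ℝ), ℝ⟯, f =ᶠ[𝓝 x] h := by
  obtain ⟨b, -, hb⟩ := (SmoothBumpFunction.nhds_basis_tsupport x :
    (𝓝 x).HasBasis (fun _ : SmoothBumpFunction (𝓡 m) x => True) _).mem_iff.1 (hO.mem_nhds hx)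
  refine ⟨⟨fun y => b y * h y, contMDiff_of_tsupport fun y hy => ?_⟩, ?_⟩
  · exact b.contMDiffAt.mul
      (hh.contMDiffAt (hO.mem_nhds (hb (closure_mono (Function.support_mul_subset_left _ _) hy))))
  · filter_upwards [b.eventuallyEq_one] with y hy
    change b y * h y = h y
    rw [hy, Pi.one_apply, one_mul]

/-- A vector which is not tangent to an embedded submanifold is detected by a smooth function which
vanishes on the submanifold near its base point. -/
lemma exists_smooth_vanishing_on_range [T2Space M] {φ : N → M}
    (hφ : Manifold.IsSmoothEmbedding (𝓡 n) (𝓡 m) ∞ φ) (p : N) (v : TangentSpace (𝓡 m) (φ p))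
    (hv : ∀ u : TangentSpace (𝓡 n) p, mfderiv (𝓡 n) (𝓡 m) φ p u ≠ v) :
    ∃ f : C^∞⟮𝓡 m, M; 𝓘(ℝ), ℝ⟯, 0 < smoothDeriv f (φ p) v ∧
      ∀ᶠ y in 𝓝 (φ p), y ∈ Set.range φ → f y = 0 := by
  obtain ⟨F, _, _, hF⟩ := hφ.isImmersion
  -- Immersion normal form: in the charts `α`, `β` the map is `z ↦ A (z, 0)`.
  obtain ⟨α, β, hpα, hpβ, hα, hβ, hαβ, A, hA⟩ := hF p
  have hA' : ∀ z ∈ α.target, β (φ (α.symm z)) = A (z, 0) := fun z hz => hA (by simpa using hz)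
  have hβs : ContMDiffOn (𝓡 m) (𝓡 m) ∞ β β.source := contMDiffOn_of_mem_maximalAtlas hβ
  have hβd : MDifferentiableAt (𝓡 m) (𝓡 m) β (φ p) :=
    (hβs.contMDiffAt (β.open_source.mem_nhds hpβ)).mdifferentiableAt (by simp)
  have hβsymm : MDifferentiableAt (𝓡 m) (𝓡 m) β.symm (β (φ p)) :=
    ((contMDiffOn_symm_of_mem_maximalAtlas hβ).contMDiffAt
      (β.open_target.mem_nhds (β.map_source hpβ))).mdifferentiableAt (by simp)
  have hαsymm : MDifferentiableAt (𝓡 n) (𝓡 n) α.symm (α p) :=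
    ((contMDiffOn_symm_of_mem_maximalAtlas hα).contMDiffAt
      (α.open_target.mem_nhds (α.map_source hpα))).mdifferentiableAt (by simp)
  let Dβ : EuclideanSpace ℝ (Fin m) →L[ℝ] EuclideanSpace ℝ (Fin m) := mfderiv (𝓡 m) (𝓡 m) β (φ p)
  let Dβ' : EuclideanSpace ℝ (Fin m) →L[ℝ] EuclideanSpace ℝ (Fin m) :=
    mfderiv (𝓡 m) (𝓡 m) β.symm (β (φ p))
  let Dα' : EuclideanSpace ℝ (Fin n) →L[ℝ] EuclideanSpace ℝ (Fin n) :=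
    mfderiv (𝓡 n) (𝓡 n) α.symm (α p)
  let Dφ : EuclideanSpace ℝ (Fin n) →L[ℝ] EuclideanSpace ℝ (Fin m) := mfderiv (𝓡 n) (𝓡 m) φ p
  let v' : EuclideanSpace ℝ (Fin m) := v
  have hinv : Dβ' (Dβ v') = v' := by
    have h1 : HasMFDerivAt (𝓡 m) (𝓡 m) (β.symm ∘ β) (φ p) (Dβ'.comp Dβ) :=
      HasMFDerivAt.comp (φ p) hβsymm.hasMFDerivAt hβd.hasMFDerivAt
    have h2 : HasMFDerivAt (𝓡 m) (𝓡 m) (β.symm ∘ β) (φ p)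
        (ContinuousLinearMap.id ℝ (EuclideanSpace ℝ (Fin m))) := by
      refine (hasMFDerivAt_id (φ p)).congr_of_eventuallyEq ?_
      filter_upwards [β.open_source.mem_nhds hpβ] with y hy using β.left_inv hy
    exact congr($(hasMFDerivAt_unique h1 h2) v')
  -- If the transverse component vanished, differentiating `φ ∘ α⁻¹ = β⁻¹ ∘ A(·, 0)` would exhibit
  -- `v` as a tangent vector of `N`.
  have hne : (A.symm (Dβ v')).2 ≠ 0 := by
    intro h0
    have hu : A ((A.symm (Dβ v')).1, 0) = Dβ v' := by
      rw [← h0, Prod.mk.eta, A.apply_symm_apply]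
    have hφd : ∀ z, z = p → HasMFDerivAt (𝓡 n) (𝓡 m) φ z Dφ := by
      rintro _ rfl
      exact (hφ.contMDiff.mdifferentiableAt (by simp)).hasMFDerivAt
    have hβz : ∀ z, z = β (φ p) → HasMFDerivAt (𝓡 m) (𝓡 m) β.symm z Dβ' := by
      rintro _ rfl
      exact hβsymm.hasMFDerivAt
    have h1 : HasMFDerivAt (𝓡 n) (𝓡 m) (φ ∘ α.symm) (α p) (Dφ.comp Dα') :=
      (hφd _ (α.left_inv hpα)).comp (α p) hαsymm.hasMFDerivAt
    let L : EuclideanSpace ℝ (Fin n) →L[ℝ] EuclideanSpace ℝ (Fin m) :=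
      A.toContinuousLinearMap.comp (ContinuousLinearMap.inl ℝ _ F)
    have hL : ∀ z, L z = A (z, 0) := fun z => rfl
    have hLd : HasMFDerivAt (𝓡 n) (𝓡 m) L (α p) L := L.hasFDerivAt.hasMFDerivAt
    have h2 : HasMFDerivAt (𝓡 n) (𝓡 m) (β.symm ∘ L) (α p) (Dβ'.comp L) := by
      refine (hβz _ ?_).comp (α p) hLd
      rw [hL, ← hA' _ (α.map_source hpα), α.left_inv hpα]
    have h3 : (φ ∘ α.symm) =ᶠ[𝓝 (α p)] (β.symm ∘ L) := by
      filter_upwards [α.open_target.mem_nhds (α.map_source hpα)] with z hz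
      rw [Function.comp_apply, Function.comp_apply, hL, ← hA' z hz,
        β.left_inv (hαβ (α.map_target hz))]
    have h4 := hasMFDerivAt_unique h1 (h2.congr_of_eventuallyEq h3)
    refine hv (Dα' (A.symm (Dβ v')).1) ?_
    have h5 : Dφ (Dα' (A.symm (Dβ v')).1) = Dβ' (A ((A.symm (Dβ v')).1, 0)) :=
      congr($h4 (A.symm (Dβ v')).1)
    rw [hu, hinv] at h5
    exact h5
  -- The detecting function is a norming functional `ℓ` of the transverse coordinate, which is zero
  -- on the submanifold.
  obtain ⟨ℓ, -, hℓ⟩ := exists_dual_vector ℝ _ (norm_ne_zero_iff.2 hne)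
  let Q : EuclideanSpace ℝ (Fin m) →L[ℝ] ℝ :=
    ℓ.comp ((ContinuousLinearMap.snd ℝ _ F).comp A.symm.toContinuousLinearMap)
  have hQ : ∀ y, Q y = ℓ (A.symm y).2 := fun y => rfl
  obtain ⟨f, hf⟩ := exists_smooth_eventuallyEq β.open_source hpβ
    (h := Q ∘ β) (Q.contDiff.contMDiff.comp_contMDiffOn hβs)
  refine ⟨f, ?_, ?_⟩
  · have h1 : HasMFDerivAt (𝓡 m) 𝓘(ℝ) (Q ∘ β) (φ p) (Q.comp Dβ) :=
      HasMFDerivAt.comp (φ p) (Q.hasFDerivAt.hasMFDerivAt) hβd.hasMFDerivAt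
    have h2 : smoothDeriv f (φ p) v = Q (Dβ v') :=
      congr($((h1.congr_of_eventuallyEq hf).mfderiv) v')
    rw [h2, hQ, hℓ]
    exact norm_pos_iff.2 hne
  -- The embedding property ensures that points of the range near `φ p` come from parameters near
  -- `p`, where the normal form applies.
  · have hO : ∀ᶠ q in 𝓝 p, q ∈ α.source := α.open_source.mem_nhds hpα
    rw [hφ.isEmbedding.nhds_eq_comap, Filter.eventually_comap] at hO
    filter_upwards [hf, hO] with y hfy hy
    rintro ⟨q, rfl⟩
    have hq := hy q rfl
    rw [hfy, Function.comp_apply, hQ]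
    have := hA' _ (α.map_source hq)
    rw [α.left_inv hq] at this
    rw [this, A.symm_apply_apply, map_zero]

/-- A family of self-maps whose initial velocity is nowhere tangent to a compact embedded
submanifold moves it off itself. -/
lemma exists_forall_notMem_range [T2Space M] [CompactSpace M] [CompactSpace N] {φ : N → M}
    (hφ : Manifold.IsSmoothEmbedding (𝓡 n) (𝓡 m) ∞ φ) {F : ℝ → M → M}
    {v : ∀ x : M, TangentSpace (𝓡 m) x} (hF : IsSmoothFamily m F) (hF0 : ∀ x, F 0 x = x)
    (hFv : HasInitialVelocity F v)
    (hv : ∀ (p : N) (u : TangentSpace (𝓡 n) p), mfderiv (𝓡 n) (𝓡 m) φ p u ≠ v (φ p)) :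
    ∃ δ > 0, ∀ τ, 0 < τ → τ < δ → ∀ q, F τ (φ q) ∉ Set.range φ := by
  have hφc := hφ.isEmbedding.continuous
  let P (S : Set N) : Prop := ∃ δ > 0, ∀ τ, 0 < τ → τ < δ → ∀ q ∈ S, F τ (φ q) ∉ Set.range φ
  suffices h : P Set.univ by
    obtain ⟨δ, hδ, h⟩ := h
    exact ⟨δ, hδ, fun τ h0 h1 q => h τ h0 h1 q trivial⟩
  refine isCompact_univ.induction_on (p := P) ?_ ?_ ?_ ?_
  · exact ⟨1, one_pos, fun _ _ _ q hq => hq.elim⟩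
  · rintro S T hST ⟨δ, hδ, h⟩
    exact ⟨δ, hδ, fun τ h0 h1 q hq => h τ h0 h1 q (hST hq)⟩
  · rintro S T ⟨δ, hδ, h⟩ ⟨δ', hδ', h'⟩
    refine ⟨min δ δ', lt_min hδ hδ', fun τ h0 h1 q hq => ?_⟩
    rcases hq with hq | hq
    · exact h τ h0 (h1.trans_le (min_le_left _ _)) q hq
    · exact h' τ h0 (h1.trans_le (min_le_right _ _)) q hq
  · intro p _
    obtain ⟨f, hfpos, hf0⟩ := exists_smooth_vanishing_on_range hφ p (v (φ p)) (hv p)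
    obtain ⟨ι, _, U, Γ, hΓ, hrep⟩ := hF f
    let D : ℝ × N → ℝ := fun z => fderiv ℝ Γ (z.1, fun i => U i (φ z.2)) (1, 0)
    have hUc : Continuous fun z : ℝ × N => ((z.1, fun i => U i (φ z.2)) : ℝ × (ι → ℝ)) :=
      continuous_fst.prodMk (continuous_pi fun i =>
        (U i).contMDiff.continuous.comp (hφc.comp continuous_snd))
    have hDc : Continuous D :=
      ((hΓ.continuous_fderiv (by simp)).comp hUc).clm_apply continuous_const
    have hD (τ : ℝ) (q : N) : HasDerivAt (fun τ => f (F τ (φ q))) (D (τ, q)) τ := by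
      simp only [hrep]
      exact HasFDerivAt.comp_hasDerivAt (l := Γ) (f := fun τ : ℝ => (τ, fun i => U i (φ q))) τ
        (hΓ.differentiable (by simp) _).hasFDerivAt ((hasDerivAt_id τ).prodMk (hasDerivAt_const _ _))
    have hDp : 0 < D (0, p) := by
      rw [(hD 0 p).unique (hFv f (φ p))]
      exact hfpos
    have hFc : Continuous fun z : ℝ × N => F z.1 (φ z.2) :=
      hF.continuous_uncurry.comp (continuous_fst.prodMk (hφc.comp continuous_snd))
    have e1 : ∀ᶠ z in 𝓝 ((0 : ℝ), p), 0 < D z := hDc.continuousAt.eventually_const_lt hDp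
    have e2 : ∀ᶠ z in 𝓝 ((0 : ℝ), p), F z.1 (φ z.2) ∈ Set.range φ → f (F z.1 (φ z.2)) = 0 :=
      (hFc.continuousAt (x := ((0 : ℝ), p))).eventually
        (show ∀ᶠ y in 𝓝 (F 0 (φ p)), y ∈ Set.range φ → f y = 0 by rwa [hF0])
    obtain ⟨W, hW, V, hV, hWV⟩ := mem_nhds_prod_iff.1 (e1.and e2)
    obtain ⟨δ, hδ, hδW⟩ := Metric.mem_nhds_iff.1 hW
    have hmem (t : ℝ) (h0 : 0 ≤ t) (h1 : t < δ) (q : N) (hq : q ∈ V) :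
        0 < D (t, q) ∧ (F t (φ q) ∈ Set.range φ → f (F t (φ q)) = 0) :=
      hWV (Set.mk_mem_prod (hδW (by simpa [abs_of_nonneg h0] using h1)) hq)
    refine ⟨V, mem_nhdsWithin_of_mem_nhds hV, δ, hδ, fun τ h0 h1 q hq hr => ?_⟩
    -- Along the motion `f` starts at `0` and strictly increases, whereas it would vanish again on a
    -- return to the range.
    have hmono : StrictMonoOn (fun τ => f (F τ (φ q))) (Set.Icc 0 τ) := by
      refine strictMonoOn_of_deriv_pos (convex_Icc _ _)
        (fun t _ => (hD t q).continuousAt.continuousWithinAt) fun t ht => ?_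
      rw [interior_Icc] at ht
      rw [(hD t q).deriv]
      exact (hmem t ht.1.le (ht.2.trans h1) q hq).1
    have hlt := hmono (Set.left_mem_Icc.2 h0.le) (Set.right_mem_Icc.2 h0.le) h0
    beta_reduce at hlt
    have hz : f (F 0 (φ q)) = 0 :=
      (hmem 0 le_rfl hδ q hq).2 (by rw [hF0]; exact ⟨q, rfl⟩)
    rw [hz, (hmem τ h0.le h1 q hq).2 hr] at hlt
    exact lt_irrefl _ hlt

end Disjoint

/-! ### Loops of zero energy are constant -/

section Energy

variable {m : ℕ} {M : Type u} [TopologicalSpace M] [ChartedSpace (EuclideanSpace ℝ (Fin m)) M]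

lemma FreeLoop.continuous_extend (γ : FreeLoop m M) : Continuous γ.extend :=
  γ.curve.continuous.Icc_extend'

lemma FreeLoop.deriv_alongCurve {γ : FreeLoop m M} {t : ℝ}
    (h : MDifferentiableAt 𝓘(ℝ) (𝓡 m) γ.extend t) (f : C^∞⟮𝓡 m, M; 𝓘(ℝ), ℝ⟯) :
    deriv (alongCurve f γ.curve) t = smoothDeriv f (γ.extend t) (γ.velocity t) := by
  have h1 : HasMFDerivAt (𝓡 m) 𝓘(ℝ) f (γ.extend t) (smoothDeriv f (γ.extend t)) :=
    (f.contMDiff.mdifferentiableAt (by simp)).hasMFDerivAt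
  let L : ℝ →L[ℝ] EuclideanSpace ℝ (Fin m) := mfderiv 𝓘(ℝ) (𝓡 m) γ.extend t
  have h2 : HasFDerivAt (alongCurve f γ.curve)
      ((smoothDeriv f (γ.extend t) : EuclideanSpace ℝ (Fin m) →L[ℝ] ℝ).comp L) t :=
    (h1.comp t h.hasMFDerivAt).hasFDerivAt
  exact h2.hasDerivAt.deriv

variable [IsManifold (𝓡 m) ∞ M]

/-- Coordinates cut off by a bump are smooth functions on `M`, hence absolutely continuous along the
loop and differentiable almost everywhere; finitely many charts suffice. Since `mfderiv` is `0`
where the derivative does not exist, the energy says nothing about the loop without this. -/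
lemma FreeLoop.ae_mdifferentiableAt_extend [T2Space M] [CompactSpace M] (γ : FreeLoop m M) :
    ∀ᵐ t ∂unitMeasure, MDifferentiableAt 𝓘(ℝ) (𝓡 m) γ.extend t := by
  let P (S : Set M) : Prop :=
    ∀ᵐ t ∂unitMeasure, γ.extend t ∈ S → MDifferentiableAt 𝓘(ℝ) (𝓡 m) γ.extend t
  suffices h : P Set.univ from h.mono fun t ht => ht (Set.mem_univ _)
  refine isCompact_univ.induction_on (p := P) ?_ ?_ ?_ ?_
  · exact Filter.Eventually.of_forall fun t ht => ht.elim
  · exact fun S T hST h => h.mono fun t ht hS => ht (hST hS)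
  · exact fun S T hS hT => by
      filter_upwards [hS, hT] with t h1 h2 using fun h => h.elim h1 h2
  · intro x _
    let β : SmoothBumpFunction (𝓡 m) x := Classical.choice inferInstance
    have hu := β.contMDiff_smul (contMDiffOn_extChartAt :
      ContMDiffOn (𝓡 m) 𝓘(ℝ, EuclideanSpace ℝ (Fin m)) ∞ (extChartAt (𝓡 m) x)
        (chartAt (EuclideanSpace ℝ (Fin m)) x).source)
    let u (j : Fin m) : C^∞⟮𝓡 m, M; 𝓘(ℝ), ℝ⟯ :=
      ⟨fun y => (β y • extChartAt (𝓡 m) x y) j,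
        (contDiff_euclidean.1 contDiff_id j).contMDiff.comp hu⟩
    obtain ⟨O, hO, hOo, hxO⟩ := eventually_nhds_iff.1 (β.eventuallyEq_one.and
      (show ∀ᶠ y in 𝓝 x, y ∈ (extChartAt (𝓡 m) x).source from extChartAt_source_mem_nhds x))
    refine ⟨O, mem_nhdsWithin_of_mem_nhds (hOo.mem_nhds hxO), ?_⟩
    have hdiff : ∀ᵐ t ∂unitMeasure, ∀ j, DifferentiableAt ℝ (alongCurve (u j) γ.curve) t := by
      rw [Filter.eventually_all]
      intro j
      have := (γ.2.2.absolutelyContinuous (u j)).ae_differentiableAt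
      rw [Set.uIcc_of_le zero_le_one] at this
      exact (ae_restrict_iff' measurableSet_Icc).2 this
    filter_upwards [hdiff] with t ht htO
    have hnear : ∀ᶠ r in 𝓝 t, γ.extend r ∈ O :=
      γ.continuous_extend.continuousAt.eventually (hOo.mem_nhds htO)
    have h1 : DifferentiableAt ℝ (fun r => extChartAt (𝓡 m) x (γ.extend r)) t := by
      refine (differentiableAt_euclidean.2 fun j => ?_)
      refine (ht j).congr_of_eventuallyEq ?_
      filter_upwards [hnear] with r hr
      change _ = (β (γ.extend r) • extChartAt (𝓡 m) x (γ.extend r)) j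
      rw [(hO _ hr).1, Pi.one_apply, one_smul]
    have hmem : extChartAt (𝓡 m) x (γ.extend t) ∈ (extChartAt (𝓡 m) x).target :=
      (extChartAt (𝓡 m) x).map_source (hO _ htO).2
    have h2 : MDifferentiableAt 𝓘(ℝ, EuclideanSpace ℝ (Fin m)) (𝓡 m) (extChartAt (𝓡 m) x).symm
        (extChartAt (𝓡 m) x (γ.extend t)) :=
      ((contMDiffOn_extChartAt_symm (n := ∞) x).contMDiffAt
        ((isOpen_extChartAt_target x).mem_nhds hmem)).mdifferentiableAt (by simp)
    refine (h2.comp t h1.mdifferentiableAt).congr_of_eventuallyEq ?_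
    filter_upwards [hnear] with r hr
    exact ((extChartAt (𝓡 m) x).left_inv (hO _ hr).2).symm

open scoped Bundle in
/-- The differential of a smooth function on a compact Riemannian manifold is bounded. -/
lemma exists_smoothDeriv_sq_le [CompactSpace M] (g : RiemannianMetric m M)
    (f : C^∞⟮𝓡 m, M; 𝓘(ℝ), ℝ⟯) :
    ∃ C : ℝ, 0 ≤ C ∧ ∀ (x : M) (v : TangentSpace (𝓡 m) x),
      smoothDeriv f x v ^ 2 ≤ C * g.inner x v v := by
  let : Bundle.RiemannianBundle (fun p : M => TangentSpace (𝓡 m) p) :=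
    ⟨g.toContinuousRiemannianMetric.toRiemannianMetric⟩
  have hg (x : M) (v : TangentSpace (𝓡 m) x) : g.inner x v v = ‖v‖ ^ 2 :=
    real_inner_self_eq_norm_sq v
  let P (S : Set M) : Prop := ∃ C : ℝ, 0 ≤ C ∧ ∀ x ∈ S, ∀ v : TangentSpace (𝓡 m) x,
      |smoothDeriv f x v| ≤ C * ‖v‖
  suffices h : P Set.univ by
    obtain ⟨C, hC, h⟩ := h
    refine ⟨C ^ 2, sq_nonneg C, fun x v => ?_⟩
    rw [hg, ← mul_pow]
    exact sq_le_sq' (abs_le.1 (h x trivial v)).1 (abs_le.1 (h x trivial v)).2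
  refine isCompact_univ.induction_on (p := P) ?_ ?_ ?_ ?_
  · exact ⟨0, le_rfl, fun x hx => hx.elim⟩
  · rintro S T hST ⟨C, hC, h⟩
    exact ⟨C, hC, fun x hx => h x (hST hx)⟩
  · rintro S T ⟨C, hC, h⟩ ⟨C', hC', h'⟩
    refine ⟨C + C', add_nonneg hC hC', fun x hx v => ?_⟩
    rw [add_mul]
    have h0 := norm_nonneg v
    rcases hx with hx | hx
    · exact (h x hx v).trans (le_add_of_nonneg_right (by positivity))
    · exact (h' x hx v).trans (le_add_of_nonneg_left (by positivity))
  · intro x _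
    have : IsManifold (𝓡 m) 1 M := IsManifold.of_le (n := ∞) (by simp)
    let ψ := extChartAt (𝓡 m) x
    obtain ⟨C, hC, hbound⟩ := eventually_norm_trivializationAt_lt (EuclideanSpace ℝ (Fin m))
      (fun p : M => TangentSpace (𝓡 m) p) x
    have hsymm (y) (hy : y ∈ ψ.source) : ContDiffAt ℝ ∞ (f ∘ ψ.symm) (ψ y) := by
      refine contMDiffAt_iff_contDiffAt.1 (f.contMDiff.contMDiffAt.comp _ ?_)
      exact (contMDiffOn_extChartAt_symm x).contMDiffAt
        ((isOpen_extChartAt_target x).mem_nhds (ψ.map_source hy))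
    have hcont : ContinuousAt (fun y => ‖fderiv ℝ (f ∘ ψ.symm) (ψ y)‖) x :=
      (((hsymm x (mem_extChartAt_source x)).fderiv_right (m := 0) (by simp)).continuousAt.comp
        (continuousAt_extChartAt x)).norm
    have hlt := hcont.eventually_lt_const (lt_add_one _)
    set K := ‖fderiv ℝ (f ∘ ψ.symm) (ψ x)‖ + 1
    have hK : 0 ≤ K := by positivity
    refine ⟨_, mem_nhdsWithin_of_mem_nhds ((hlt.and hbound).and
      (show ∀ᶠ y in 𝓝 x, y ∈ ψ.source from extChartAt_source_mem_nhds x)),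
      K * C, by positivity, ?_⟩
    rintro y ⟨⟨hy1, hy2⟩, hy3⟩ v
    have hy3' : y ∈ (chartAt (EuclideanSpace ℝ (Fin m)) x).source := by simpa [ψ] using hy3
    -- The differential factors through the trivialization; both factors are bounded near `x`.
    have hchain : smoothDeriv f y v = fderiv ℝ (f ∘ ψ.symm) (ψ y)
        ((trivializationAt (EuclideanSpace ℝ (Fin m)) (fun p : M => TangentSpace (𝓡 m) p)
          x).continuousLinearMapAt ℝ y v) := by
      have h1 : HasMFDerivAt (𝓡 m) 𝓘(ℝ) ((f ∘ ψ.symm) ∘ ψ) y _ :=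
        HasMFDerivAt.comp y
          ((hsymm y hy3).differentiableAt (by simp)).hasFDerivAt.hasMFDerivAt
          (mdifferentiableAt_extChartAt hy3').hasMFDerivAt
      have h2 : f =ᶠ[𝓝 y] ((f ∘ ψ.symm) ∘ ψ) := by
        filter_upwards [(isOpen_extChartAt_source x).mem_nhds hy3] with z hz
        exact congrArg f (ψ.left_inv hz).symm
      have h3 := (h1.congr_of_eventuallyEq h2).mfderiv
      rw [TangentBundle.continuousLinearMapAt_trivializationAt hy3']
      exact congr($h3 v)
    rw [hchain, ← Real.norm_eq_abs]
    refine (ContinuousLinearMap.le_opNorm _ _).trans ?_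
    rw [mul_assoc]
    exact mul_le_mul hy1.le ((ContinuousLinearMap.le_opNorm _ _).trans
      (mul_le_mul_of_nonneg_right hy2.le (norm_nonneg v))) (norm_nonneg _) hK

/-- The energy dominates `∫ |(f ∘ γ)'|²`, so every `f ∘ γ` is absolutely continuous with derivative
zero almost everywhere, hence constant; smooth functions separate points. -/
lemma eq_trivial_of_energy_eq_zero [T2Space M] [CompactSpace M] (g : RiemannianMetric m M)
    {γ : FreeLoop m M} (hγ : energy g γ = 0) : γ = FreeLoop.trivial m (γ.curve 0) := by
  have hconst (f : C^∞⟮𝓡 m, M; 𝓘(ℝ), ℝ⟯) (t : I) : f (γ.curve t) = f (γ.curve 0) := by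
    have hac := γ.2.2.absolutelyContinuous f
    obtain ⟨C, hC, hbound⟩ := exists_smoothDeriv_sq_le g f
    have hint : ∫⁻ t, ENNReal.ofReal (deriv (alongCurve f γ.curve) t ^ 2) ∂unitMeasure = 0 := by
      refine le_antisymm ?_ zero_le
      calc ∫⁻ t, ENNReal.ofReal (deriv (alongCurve f γ.curve) t ^ 2) ∂unitMeasure
          ≤ ∫⁻ t, ENNReal.ofReal C * ENNReal.ofReal
              (g.inner (γ.extend t) (γ.velocity t) (γ.velocity t)) ∂unitMeasure := by
            refine lintegral_mono_ae ?_
            filter_upwards [γ.ae_mdifferentiableAt_extend] with t ht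
            rw [← ENNReal.ofReal_mul hC, FreeLoop.deriv_alongCurve ht]
            exact ENNReal.ofReal_le_ofReal (hbound _ _)
        _ = ENNReal.ofReal C * energy g γ := lintegral_const_mul' _ _ ENNReal.ofReal_ne_top
        _ = 0 := by rw [hγ, mul_zero]
    have hmeas : Measurable fun t => ENNReal.ofReal (deriv (alongCurve f γ.curve) t ^ 2) :=
      ((measurable_deriv _).pow_const 2).ennreal_ofReal
    rw [lintegral_eq_zero_iff hmeas] at hint
    have hae : ∀ᵐ t, t ∈ Set.uIcc (0 : ℝ) 1 → deriv (alongCurve f γ.curve) t ^ 2 ≤ 0 := by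
      rw [Set.uIcc_of_le zero_le_one]
      refine (ae_restrict_iff' measurableSet_Icc).1 ?_
      filter_upwards [hint] with t ht using ENNReal.ofReal_eq_zero.1 ht
    obtain ⟨c, hc⟩ := hac.const_of_ae_hasDerivAt_zero (by
      filter_upwards [hae, hac.ae_differentiableAt] with t h1 h2 ht
      have h0 : deriv (alongCurve f γ.curve) t = 0 :=
        pow_eq_zero_iff (two_ne_zero) |>.1 (le_antisymm (h1 ht) (sq_nonneg _))
      exact h0 ▸ (h2 ht).hasDerivAt)
    rw [Set.uIcc_of_le zero_le_one] at hc
    have key (t : I) : f (γ.curve t) = c :=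
      (Set.IccExtend_val (zero_le_one' ℝ) (fun t => f (γ.curve t)) t).symm.trans (hc t t.2)
    rw [key, key]
  refine Subtype.ext (ContinuousMap.ext fun t => ?_)
  exact eq_of_forall_smooth_eq fun f => hconst f t

end Energy

/-! ### Counting base point parameters; the two bounds -/

section Main

variable {m n : ℕ}
  {M : Type u} [TopologicalSpace M] [T2Space M] [CompactSpace M]
  [ChartedSpace (EuclideanSpace ℝ (Fin m)) M] [IsManifold (𝓡 m) ∞ M]
  {N : Type u} [TopologicalSpace N] [CompactSpace N]
  [ChartedSpace (EuclideanSpace ℝ (Fin n)) N]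

lemma toEReal_two_sub_one : (((2 : ℕ∞) : ENNReal) : EReal) - 1 = 1 := by
  have h : (((2 : ℕ∞) : ENNReal) : EReal) = ((2 : ℝ) : EReal) := rfl
  rw [h, ← EReal.coe_one, ← EReal.coe_sub]
  norm_num

lemma toEReal_sub_one_le_one {x : ℕ∞} (hx : x ≤ 2) : ((x : ENNReal) : EReal) - 1 ≤ 1 :=
  (EReal.sub_le_sub (EReal.coe_ennreal_le_coe_ennreal_iff.2 (ENat.toENNReal_le.2 hx))
    le_rfl).trans_eq toEReal_two_sub_one

lemma one_le_toEReal_sub_one {x : ℕ∞} (hx : 2 ≤ x) : 1 ≤ ((x : ENNReal) : EReal) - 1 :=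
  toEReal_two_sub_one.symm.trans_le
    (EReal.sub_le_sub (EReal.coe_ennreal_le_coe_ennreal_iff.2 (ENat.toENNReal_le.2 hx)) le_rfl)

omit [T2Space M] [CompactSpace M] [IsManifold (𝓡 m) ∞ M] in
lemma two_le_basepointCount (γ : FreeLoop m M) : 2 ≤ basepointCount γ := by
  have h : ({0, 1} : Set I) ⊆ {t : I | γ.curve t = γ.curve 0} := by
    rintro t (rfl | rfl)
    · rfl
    · exact γ.2.1.symm
  refine le_trans ?_ (Set.encard_le_encard h)
  rw [Set.encard_pair zero_ne_one]

omit [T2Space M] [CompactSpace M] [IsManifold (𝓡 m) ∞ M] in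
lemma basepointCount_le_two {γ : FreeLoop m M}
    (h : ∀ t : I, γ.curve t = γ.curve 0 → t = 0 ∨ t = 1) : basepointCount γ ≤ 2 :=
  (Set.encard_le_encard (t := {0, 1}) fun t ht => h t ht).trans (Set.encard_insert_le _ _ |>.trans
    (by rw [Set.encard_singleton]; norm_num))

/-- The map of loop spaces induced by an embedding with a nowhere vanishing normal section is
homotopic to a map whose values are loops which pass through their base point only at the ends. -/
lemma exists_homotopy_basepointCount_le_two (g : RiemannianMetric m M) (φ : C^∞⟮𝓡 n, N; 𝓡 m, M⟯)
    (hφ : Manifold.IsSmoothEmbedding (𝓡 n) (𝓡 m) ∞ φ)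
    (hE : HasNowhereVanishingNormalSection (n := n) g φ) :
    ∃ h : C(FreeLoop n N, FreeLoop m M), (∀ γ, basepointCount (h γ) ≤ 2) ∧
      ContinuousMap.Homotopic ⟨FreeLoop.map φ, FreeLoop.continuous_map φ⟩ h := by
  obtain ⟨s, hs, hs0⟩ := hE
  obtain ⟨F, v, hF, hF0, hFv, hpos⟩ := exists_isSmoothFamily_inner_pos g hφ.isEmbedding
    (fun p => (s p : TangentSpace (𝓡 m) (φ p))) hs fun p hp => hs0 p (Subtype.ext hp)
  -- Tangent vectors are orthogonal to `s p`, while the velocity has positive product with it.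
  obtain ⟨δ, hδ, hdisj⟩ := exists_forall_notMem_range hφ hF hF0 hFv fun p u hu =>
    ((hpos p).trans_eq ((s p).2 u ▸ hu ▸ rfl)).false
  obtain ⟨H, hH⟩ := hF.exists_loop_homotopy hF0 δ
  have hcont : Continuous fun z : I × FreeLoop n N => H (z.1, FreeLoop.map φ z.2) :=
    H.continuous.comp (continuous_fst.prodMk ((FreeLoop.continuous_map φ).comp continuous_snd))
  refine ⟨⟨fun γ => H (1, FreeLoop.map φ γ), hcont.comp (continuous_const.prodMk continuous_id)⟩,
    fun γ => basepointCount_le_two fun t ht => ?_, ⟨⟨⟨_, hcont⟩, fun γ => ?_, fun γ => rfl⟩⟩⟩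
  · by_contra! hne
    have h0 : (0 : ℝ) < t := unitInterval.pos_iff_ne_zero.2 hne.1
    have h1 : (t : ℝ) < 1 := unitInterval.lt_one_iff_ne_one.2 hne.2
    change (H (1, FreeLoop.map φ γ)).curve t = (H (1, FreeLoop.map φ γ)).curve 0 at ht
    rw [hH, hH] at ht
    simp only [Set.Icc.coe_zero, zero_mul, mul_zero, hF0, Set.Icc.coe_one, one_mul] at ht
    -- For `0 < t < 1` the time lies strictly between `0` and `δ`, so the point has left `N`, while
    -- the base point is still `φ (γ 0)`.
    refine hdisj (δ * (t * (1 - t))) (by nlinarith [mul_pos h0 (sub_pos.2 h1)]) ?_ (γ.curve t)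
      ⟨γ.curve 0, ht.symm⟩
    have : (t : ℝ) * (1 - t) < 1 := by nlinarith
    nlinarith
  · refine Subtype.ext (ContinuousMap.ext fun t => ?_)
    refine (hH 0 _ t).trans ?_
    simp only [Set.Icc.coe_zero, zero_mul, hF0]
    rfl

omit [CompactSpace N] in
lemma exists_relativeClass_eq (R : Type u) [CommRing R] (k : ℕ)
    (X : relativeHomology R (loopPair n N) k) : ∃ z, relativeClass R (loopPair n N) k z = X :=
  relativeClass_surjective R (loopPair n N)
    -- Evaluation at the base point retracts the loop space onto the constant loops.
    (TopCat.ofHom ⟨fun γ : FreeLoop n N => γ.curve 0,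
      (continuous_eval_const (0 : I)).comp FreeLoop.continuous_curve⟩) rfl k X

lemma relativeClass_eq_zero_of_energy_eq_zero (R : Type u) [CommRing R] (g : RiemannianMetric m M)
    (k : ℕ) (z : (singularChains R (TopCat.of (FreeLoop m M))).cycles k)
    (hz : ∀ γ ∈ chainImage R (TopCat.of (FreeLoop m M)) k
      ((singularChains R (TopCat.of (FreeLoop m M))).iCycles k z), energy g γ = 0) :
    relativeClass R (loopPair m M) k z = 0 :=
  relativeClass_eq_zero_of_chainImage_subset R (loopPair m M) k z fun γ hγ =>
    ⟨_, (eq_trivial_of_energy_eq_zero g (hz γ hγ)).symm⟩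

end Main

end

end LoopHomology

open LoopHomology

theorem mainTheorem5 (R : Type u) [CommRing R] {m n : ℕ}
    {M : Type u} [TopologicalSpace M] [T2Space M] [CompactSpace M]
    [ChartedSpace (EuclideanSpace ℝ (Fin m)) M] [IsManifold (𝓡 m) ∞ M]
    {N : Type u} [TopologicalSpace N] [T2Space N] [CompactSpace N]
    [ChartedSpace (EuclideanSpace ℝ (Fin n)) N] [IsManifold (𝓡 n) ∞ N]
    (g : LoopHomology.RiemannianMetric m M)
    (φ : C^∞⟮𝓡 n, N; 𝓡 m, M⟯) (hφ : Manifold.IsSmoothEmbedding (𝓡 n) (𝓡 m) ∞ φ)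
    (hE : LoopHomology.HasNowhereVanishingNormalSection (n := n) g φ)
    (k : ℕ) (X : LoopHomology.relativeHomology R (LoopHomology.loopPair n N) k) :
    LoopHomology.intersectionMultiplicity R g k
        (LoopHomology.relativeHomologyMap R (LoopHomology.loopPairMap φ) k X) ≤ 1 ∧
      (LoopHomology.relativeHomologyMap R (LoopHomology.loopPairMap φ) k X ≠ 0 →
        LoopHomology.intersectionMultiplicity R g k
          (LoopHomology.relativeHomologyMap R (LoopHomology.loopPairMap φ) k X) = 1) := by
  refine ⟨toEReal_sub_one_le_one ?_, fun hX => le_antisymm (toEReal_sub_one_le_one ?_)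
    (one_le_toEReal_sub_one (le_iInf₂ fun A hA => ?_))⟩
  rotate_left 2
  -- Lower bound: one loop of positive energy in the image of `A` would already force the supremum
  -- up to `2`.
  · by_contra! hlt
    refine hX (hA ▸ relativeClass_eq_zero_of_energy_eq_zero R g k A fun γ hγ => ?_)
    by_contra hne
    exact hlt.not_ge ((two_le_basepointCount γ).trans
      (le_iSup₂_of_le γ hγ (le_iSup_of_le (pos_iff_ne_zero.2 hne) le_rfl)))
  -- Both remaining goals are the upper bound, witnessed by the pushforward along `h` of an absolute
  -- cycle representing `X`.
  all_goals
    obtain ⟨z, rfl⟩ := exists_relativeClass_eq R k X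
    obtain ⟨h, hcount, ⟨H⟩⟩ := exists_homotopy_basepointCount_le_two g φ hφ hE
    refine iInf₂_le_of_le (HomologicalComplex.cyclesMap (singularChainsMap R (TopCat.ofHom h)) k z)
      ?_ ?_
    · rw [relativeHomologyMap_relativeClass]
      exact (relativeClass_cyclesMap_eq_of_homotopy R (P := loopPair m M) H k z).symm
    · refine iSup₂_le fun γ hγ => iSup_le fun _ => ?_
      rw [show (singularChains R (TopCat.of (FreeLoop m M))).iCycles k
        (HomologicalComplex.cyclesMap (singularChainsMap R (TopCat.ofHom h)) k z) =
          (singularChainsMap R (TopCat.ofHom h)).f k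
            ((singularChains R (TopCat.of (FreeLoop n N))).iCycles k z) from
        congr($(HomologicalComplex.cyclesMap_i (singularChainsMap R (TopCat.ofHom h)) k) z)] at hγ
      obtain ⟨γ', rfl⟩ := chainImage_map_subset R (TopCat.ofHom h) k _ hγ
      exact hcount γ'
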